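/- Let $r \ge 3$ and let $a_1, \dots, a_r$ be integers with $a_i > 1$ for all $i$. Set $n := \max\{a_1, \dots, a_r\} + 2$. Then there exist elements $x_1, \dots, x_r$ of the symmetric group $S_n$ such that $x_i$ has order $a_i$ for every $i \in \{1, \dots, r\}$ and $x_1 x_2 \cdots x_r = 1$. -/

import Mathlib

open Equiv Equiv.Perm

namespace PermOrders

/-! ### Transpositions merging and splitting cycles -/

section

variable {α : Type*}

/-! Let c be the maximum. It suffices that elements of the other orders, acting on a set S of c
points, multiply to a c-cycle, whose inverse then supplies the order c. Order of the factors is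
irrelevant (`Realizes.perm`).

The index of a permutation has the parity of its sign and changes by at most one under a
transposition. The engine is `joinable`: if σ and τ on S have indices adding up to at least |S| - 1,
and their signs multiply to that of an |S|-cycle, then some conjugate of τ makes the product an
|S|-cycle. Packing S with a-cycles gives an element of order a and index at least (|S| - 1)/2, and
suitable products keep this bound (`exists_realizes`), so only parity can obstruct.

If another order is even and at most c - 2, transpositions placed beside its cycle correct the
parity. Otherwise every other even order is the even number e among c - 1 and c, and the count of
such entries decides. If the count is wrong, an entry e is realized by cycle type (e, 2) on e + 2 ≤
c + 2 points instead of by an e-cycle: same order, opposite sign (`exists_mul_conj_cycleType`). That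
needs e ≥ 4; what remains for c = 2 and c = 3 is explicit in S_4 and S_5. -/

theorem sameCycle_apply_self (g : Perm α) (z : α) : g.SameCycle z (g z) :=
  sameCycle_apply_right.2 SameCycle.rfl

variable [DecidableEq α]

theorem swap_mul_apply_of_ne {f : Perm α} {x y z : α} (hx : f z ≠ x) (hy : f z ≠ y) :
    (swap x y * f) z = f z := by
  rw [Perm.mul_apply, swap_apply_of_ne_of_ne hx hy]

variable [Fintype α]

/-- `f` permutes the finite set `S` as one cycle and fixes every point outside `S`. -/
def Full (f : Perm α) (S : Finset α) : Prop :=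
  f.IsCycleOn (S : Set α) ∧ f.support ⊆ S

/-- The index of a permutation: the sum of `k - 1` over its cycle lengths `k`. -/
def index (σ : Perm α) : ℕ := (σ.cycleType.map fun k => k - 1).sum

theorem Full.isCycle {f : Perm α} {S : Finset α} (h : Full f S) (hS : 1 < S.card) :
    f.IsCycle ∧ f.support = S := by
  have hnt : (S : Set α).Nontrivial := Finset.one_lt_card_iff_nontrivial.1 hS
  refine ⟨isCycle_iff_exists_isCycleOn.2 ⟨S, hnt, h.1, fun x hx => ?_⟩, ?_⟩
  · exact h.2 (mem_support.2 hx)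
  · refine h.2.antisymm fun x hx => mem_support.2 ?_
    exact h.1.apply_ne hnt hx

theorem Full.sign {f : Perm α} {S : Finset α} (h : Full f S) (hS : S.Nonempty) :
    Perm.sign f = (-1) ^ (S.card + 1) := by
  rcases Nat.lt_or_ge 1 S.card with h1 | h1
  · obtain ⟨hc, hs⟩ := h.isCycle h1
    rw [hc.sign, hs, pow_succ]
    simp
  · have h2 : S.card = 1 := le_antisymm h1 hS.card_pos
    have h3 : f.support.card ≤ 1 := (Finset.card_le_card h.2).trans h1
    rw [card_support_le_one] at h3
    simp [h3, h2]

/-- Along the `f`-orbit of `z` the swap is invisible until `x` is about to be reached; there the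
path is diverted to `y`. -/
theorem sameCycle_swap_mul_of_mem {f : Perm α} {A : Finset α} (hA : f.IsCycleOn (A : Set α))
    {x y : α} (hx : x ∈ A) (hy : y ∉ A) {z : α} (hz : z ∈ A) :
    (swap x y * f).SameCycle z y := by
  have key : ∀ n : ℕ, ∀ z ∈ A, (f ^ (n + 1)) z = x → (swap x y * f).SameCycle z y := by
    intro n
    induction n with
    | zero =>
      intro z _ h
      have h1 := sameCycle_apply_self (swap x y * f) z
      have h2 : (swap x y * f) z = y := by
        rw [Perm.mul_apply, show f z = x by simpa using h, swap_apply_left]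
      rwa [h2] at h1
    | succ n ih =>
      intro z hz h
      have h1 := sameCycle_apply_self (swap x y * f) z
      have hfz : f z ∈ A := hA.apply_mem_iff.2 hz
      by_cases hx' : f z = x
      · rwa [Perm.mul_apply, hx', swap_apply_left] at h1
      · rw [swap_mul_apply_of_ne hx' (fun h => hy (by rw [← h]; exact hfz))] at h1
        refine h1.trans (ih _ hfz ?_)
        rwa [pow_succ, Perm.mul_apply] at h
  obtain ⟨n, -, hn⟩ := hA.exists_pow_eq (hA.apply_mem_iff.2 hz) hx
  exact key n z hz (by rw [pow_succ, Perm.mul_apply, hn])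

theorem isCycleOn_swap_mul {f : Perm α} {A B : Finset α} (hA : f.IsCycleOn (A : Set α))
    (hB : f.IsCycleOn (B : Set α)) (hAB : Disjoint A B) {x y : α} (hx : x ∈ A) (hy : y ∈ B) :
    (swap x y * f).IsCycleOn ((A ∪ B : Finset α) : Set α) := by
  have hyA : y ∉ A := fun h => Finset.disjoint_left.1 hAB h hy
  have hxB : x ∉ B := fun h => Finset.disjoint_left.1 hAB hx h
  have h1 : ∀ z ∈ A, (swap x y * f).SameCycle z y := fun z hz =>
    sameCycle_swap_mul_of_mem hA hx hyA hz
  have h2 : ∀ z ∈ B, (swap x y * f).SameCycle z x := fun z hz => by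
    rw [swap_comm]; exact sameCycle_swap_mul_of_mem hB hy hxB hz
  have h3 : ∀ z ∈ A ∪ B, (swap x y * f).SameCycle z y := fun z hz => by
    rcases Finset.mem_union.1 hz with hz | hz
    · exact h1 z hz
    · exact (h2 z hz).trans (h1 x hx)
  refine ⟨Equiv.bijOn _ fun z => ?_, fun z hz w hw => (h3 z hz).trans (h3 w hw).symm⟩
  have hA' : f z ∈ A ↔ z ∈ A := hA.apply_mem_iff
  have hB' : f z ∈ B ↔ z ∈ B := hB.apply_mem_iff
  simp only [Finset.coe_union, Set.mem_union, Finset.mem_coe, Perm.mul_apply, swap_apply_def]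
  grind

/-- Multiplying by a transposition that joins two cycles merges them. -/
theorem Full.merge {f : Perm α} {A B S : Finset α} (hA : f.IsCycleOn (A : Set α))
    (hB : f.IsCycleOn (B : Set α)) (hAB : Disjoint A B) (hS : A ∪ B = S) (hf : f.support ⊆ S)
    {x y : α} (hx : x ∈ A) (hy : y ∈ B) : Full (swap x y * f) S := by
  subst hS
  refine ⟨isCycleOn_swap_mul hA hB hAB hx hy, fun z hz => ?_⟩
  rw [mem_support, Perm.mul_apply, swap_apply_def] at hz
  by_contra h
  have h1 : f z = z := by
    by_contra h2
    exact h (hf (mem_support.2 h2))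
  grind

theorem support_swap_mul_subset {f : Perm α} {S : Finset α} (hf : f.support ⊆ S) {x y : α}
    (hx : x ∈ S) (hy : y ∈ S) : (swap x y * f).support ⊆ S := by
  intro z hz
  rw [mem_support, Perm.mul_apply, swap_apply_def] at hz
  by_contra h
  have h1 : f z = z := by
    by_contra h2
    exact h (hf (mem_support.2 h2))
  grind

theorem apply_mem_iff_of_support_subset {f : Perm α} {S : Finset α} (hf : f.support ⊆ S) (z : α) :
    f z ∈ S ↔ z ∈ S := by
  by_cases h : f z = z
  · rw [h]
  · exact iff_of_true (hf (apply_mem_support.2 (mem_support.2 h))) (hf (mem_support.2 h))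

/-- Multiplying a full cycle by a transposition splits it into two cycles. -/
theorem Full.split {f : Perm α} {S : Finset α} (hf : Full f S) {x y : α} (hx : x ∈ S)
    (hy : y ∈ S) (hxy : x ≠ y) : ∃ A B : Finset α, Disjoint A B ∧ A ∪ B = S ∧ x ∈ A ∧ y ∈ B ∧
      (swap x y * f).IsCycleOn (A : Set α) ∧ (swap x y * f).IsCycleOn (B : Set α) := by
  classical
  set g := swap x y * f with hg
  have hgS : g.support ⊆ S := support_swap_mul_subset hf.2 hx hy
  have key : ∀ n : ℕ, ∀ z ∈ S, (f ^ (n + 1)) z = x → g.SameCycle x z ∨ g.SameCycle y z := by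
    intro n
    induction n with
    | zero =>
      intro z _ h
      have h1 := sameCycle_apply_self g z
      rw [hg, Perm.mul_apply, show f z = x by simpa using h, swap_apply_left, ← hg] at h1
      exact Or.inr h1.symm
    | succ n ih =>
      intro z hz h
      have h1 := sameCycle_apply_self g z
      by_cases hx' : f z = x
      · rw [hg, Perm.mul_apply, hx', swap_apply_left, ← hg] at h1
        exact Or.inr h1.symm
      by_cases hy' : f z = y
      · rw [hg, Perm.mul_apply, hy', swap_apply_right, ← hg] at h1
        exact Or.inl h1.symm
      rw [hg, swap_mul_apply_of_ne hx' hy', ← hg] at h1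
      refine (ih (f z) (hf.1.apply_mem_iff.2 hz) ?_).imp (·.trans h1.symm) (·.trans h1.symm)
      rwa [pow_succ, Perm.mul_apply] at h
  have hcov : ∀ z ∈ S, g.SameCycle x z ∨ g.SameCycle y z := by
    intro z hz
    obtain ⟨n, -, hn⟩ := hf.1.exists_pow_eq (hf.1.apply_mem_iff.2 hz) hx
    exact key n z hz (by rw [pow_succ, Perm.mul_apply, hn])
  have hsub : ∀ w ∈ S, ∀ z, g.SameCycle w z → z ∈ S := by
    intro w hw z hz
    by_cases hwz : g w = w
    · rwa [← (hz.eq_of_left hwz)]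
    · exact hgS (by rw [mem_support]; exact fun h => hwz (hz.apply_eq_self_iff.2 h))
  -- Otherwise `g` would again be one cycle on `S` and have the sign of `f`, but a transposition
  -- flips the sign.
  have hne : ¬ g.SameCycle x y := by
    intro hs
    have hfull : Full g S := by
      have h1 : ∀ z ∈ S, g.SameCycle x z := fun z hz =>
        (hcov z hz).elim id (fun h => hs.trans h)
      exact ⟨⟨Equiv.bijOn _ fun z => apply_mem_iff_of_support_subset hgS z,
        fun z hz w hw => (h1 z hz).symm.trans (h1 w hw)⟩, hgS⟩
    have h1 := hfull.sign ⟨x, hx⟩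
    rw [hg, Perm.sign_mul, sign_swap hxy, hf.sign ⟨x, hx⟩] at h1
    rcases Int.units_eq_one_or ((-1) ^ (S.card + 1)) with h | h <;> rw [h] at h1 <;>
      exact absurd h1 (by decide)
  have hcyc : ∀ w ∈ S, g.IsCycleOn ((S.filter fun z => g.SameCycle w z : Finset α) : Set α) := by
    intro w hw
    refine ⟨Equiv.bijOn _ fun z => ?_, fun z hz u hu => ?_⟩
    · simp only [Finset.coe_filter, Set.mem_ofPred_eq, sameCycle_apply_right,
        apply_mem_iff_of_support_subset hgS]
    · simp only [Finset.coe_filter, Set.mem_ofPred_eq] at hz hu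
      exact hz.2.symm.trans hu.2
  refine ⟨S.filter fun z => g.SameCycle x z, S.filter fun z => g.SameCycle y z, ?_, ?_, ?_, ?_,
    hcyc x hx, hcyc y hy⟩
  · rw [Finset.disjoint_left]
    intro z hz hz'
    exact hne ((Finset.mem_filter.1 hz).2.trans (Finset.mem_filter.1 hz').2.symm)
  · ext z
    simp only [Finset.mem_union, Finset.mem_filter]
    constructor
    · rintro (h | h) <;> exact h.1
    · intro h
      exact (hcov z h).imp (⟨h, ·⟩) (⟨h, ·⟩)
  · exact Finset.mem_filter.2 ⟨hx, SameCycle.rfl⟩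
  · exact Finset.mem_filter.2 ⟨hy, SameCycle.rfl⟩

/-- The swap of `i` and `j` splits the cycle in two; `k` lies in one part, and swapping it with
whichever of `i`, `j` lies in the other merges them again. -/
theorem Full.three_cycle_mul {u : Perm α} {S : Finset α} (hu : Full u S) {i j k : α} (hi : i ∈ S)
    (hj : j ∈ S) (hk : k ∈ S) (hij : i ≠ j) :
    Full (swap k i * (swap i j * u)) S ∨ Full (swap k j * (swap i j * u)) S := by
  obtain ⟨A, B, hd, hAB, hiA, hjB, hA, hB⟩ := hu.split hi hj hij
  have hs := support_swap_mul_subset hu.2 hi hj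
  rw [← hAB] at hk
  rcases Finset.mem_union.1 hk with hk | hk
  · exact Or.inr (Full.merge hA hB hd hAB hs hk hjB)
  · exact Or.inl (by rw [swap_comm]; exact Full.merge hA hB hd hAB hs hiA hk)

theorem Full.conj {u : Perm α} {S : Finset α} (hu : Full u S) {g : Perm α} (hg : g.support ⊆ S) :
    Full (g * u * g⁻¹) S := by
  have h1 : (g : Perm α) '' (S : Set α) = S := by
    ext z
    constructor
    · rintro ⟨w, hw, rfl⟩
      exact (apply_mem_iff_of_support_subset hg w).2 hw
    · intro hz
      exact ⟨g⁻¹ z, (apply_mem_iff_of_support_subset hg _).1 (by simpa using hz), by simp⟩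
  refine ⟨h1 ▸ hu.1.conj, fun z hz => ?_⟩
  rw [mem_support, Perm.mul_apply, Perm.mul_apply] at hz
  have h2 : g⁻¹ z ∈ S := hu.2 (mem_support.2 fun h => hz (by rw [h]; simp))
  exact by simpa using (apply_mem_iff_of_support_subset hg (g⁻¹ z)).2 h2

end

/-! ### Multiplying a full cycle by a double transposition -/

section

variable {α : Type*}

theorem pow_apply_eq_of_eqOn {f g : Perm α} {A : Finset α} (hf : f.IsCycleOn (A : Set α))
    (h : ∀ z ∈ A, f z = g z) (n : ℕ) : ∀ z ∈ A, (f ^ n) z = (g ^ n) z := by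
  induction n with
  | zero => simp
  | succ n ih =>
    intro z hz
    rw [pow_succ, pow_succ, Perm.mul_apply, Perm.mul_apply, ← h z hz]
    exact ih _ (hf.apply_mem_iff.2 hz)

theorem isCycleOn_congr {f g : Perm α} {A : Finset α} (hf : f.IsCycleOn (A : Set α))
    (h : ∀ z ∈ A, f z = g z) : g.IsCycleOn (A : Set α) := by
  refine ⟨hf.1.congr fun z hz => h z hz, fun z hz w hw => ?_⟩
  obtain ⟨n, -, hn⟩ := hf.exists_pow_eq hz hw
  exact ⟨n, by rw [zpow_natCast, ← pow_apply_eq_of_eqOn hf h n z hz, hn]⟩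

variable [DecidableEq α]

theorem four_swaps {i j k l : α} (hij : i ≠ j) (hik : i ≠ k) (hil : i ≠ l) (hjk : j ≠ k)
    (hjl : j ≠ l) (hkl : k ≠ l) (u : Perm α) :
    swap i l * (swap j k * (swap k l * (swap i j * u))) = swap i k * (swap j l * u) := by
  have h : swap i l * swap j k * swap k l * swap i j = swap i k * swap j l := by
    ext z
    simp only [Perm.mul_apply, swap_apply_def]
    grind
  rw [← mul_assoc, ← mul_assoc, ← mul_assoc, h, mul_assoc]

theorem swap_mul_swap_comm {i j k l : α} (hik : i ≠ k) (hil : i ≠ l) (hjk : j ≠ k) (hjl : j ≠ l)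
    (u : Perm α) : swap i j * (swap k l * u) = swap k l * (swap i j * u) := by
  have h : swap i j * swap k l = swap k l * swap i j := by
    ext z
    simp only [Perm.mul_apply, swap_apply_def]
    grind
  rw [← mul_assoc, ← mul_assoc, h]

variable [Fintype α]

theorem exists_full_eqOn {f : Perm α} {A : Finset α} (hf : f.IsCycleOn (A : Set α)) :
    ∃ g : Perm α, Full g A ∧ ∀ z ∈ A, f z = g z := by
  have h0 : ∀ z, f z ∈ A ↔ z ∈ A := fun z => hf.apply_mem_iff
  have h : ∀ z ∈ A, f z = ofSubtype (f.subtypePerm h0) z := fun z hz => by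
    rw [ofSubtype_apply_of_mem _ hz]; rfl
  refine ⟨ofSubtype (f.subtypePerm h0), ⟨isCycleOn_congr hf h, fun z hz => ?_⟩, h⟩
  by_contra hzA
  exact mem_support.1 hz (ofSubtype_apply_of_not_mem _ hzA)

theorem isCycleOn_split {f : Perm α} {S : Finset α} (hf : f.IsCycleOn (S : Set α)) {x y : α}
    (hx : x ∈ S) (hy : y ∈ S) (hxy : x ≠ y) :
    ∃ A B : Finset α, Disjoint A B ∧ A ∪ B = S ∧ x ∈ A ∧ y ∈ B ∧
      (swap x y * f).IsCycleOn (A : Set α) ∧ (swap x y * f).IsCycleOn (B : Set α) := by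
  obtain ⟨g, hg, hfg⟩ := exists_full_eqOn hf
  obtain ⟨A, B, hd, hAB, hxA, hyB, hA, hB⟩ := hg.split hx hy hxy
  subst hAB
  refine ⟨A, B, hd, rfl, hxA, hyB, isCycleOn_congr hA fun z hz => ?_,
    isCycleOn_congr hB fun z hz => ?_⟩
  · rw [Perm.mul_apply, Perm.mul_apply, hfg z (Finset.mem_union_left _ hz)]
  · rw [Perm.mul_apply, Perm.mul_apply, hfg z (Finset.mem_union_right _ hz)]

theorem isCycleOn_swap_mul_of_notMem {f : Perm α} {B : Finset α} (hB : f.IsCycleOn (B : Set α))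
    {x y : α} (hx : x ∉ B) (hy : y ∉ B) : (swap x y * f).IsCycleOn (B : Set α) := by
  refine isCycleOn_congr hB fun z hz => ?_
  have h : f z ∈ B := hB.apply_mem_iff.2 hz
  exact (swap_mul_apply_of_ne (ne_of_mem_of_not_mem h hx) (ne_of_mem_of_not_mem h hy)).symm

theorem Full.merge_three {v : Perm α} {A B C S : Finset α} (hA : v.IsCycleOn (A : Set α))
    (hB : v.IsCycleOn (B : Set α)) (hC : v.IsCycleOn (C : Set α)) (hAB : Disjoint A B)
    (hAC : Disjoint A C) (hBC : Disjoint B C) (hS : A ∪ B ∪ C = S) (hv : v.support ⊆ S)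
    {i j k l : α} (hi : i ∈ A) (hk : k ∈ A) (hj : j ∈ B) (hl : l ∈ C) :
    Full (swap i l * (swap j k * v)) S := by
  have h1 := isCycleOn_swap_mul hA hB hAB hk hj
  rw [swap_comm k j] at h1
  have hjC : j ∉ C := fun h => Finset.disjoint_left.1 hBC hj h
  have hkC : k ∉ C := fun h => Finset.disjoint_left.1 hAC hk h
  have hjS : j ∈ S := hS ▸ Finset.mem_union_left _ (Finset.mem_union_right _ hj)
  have hkS : k ∈ S := hS ▸ Finset.mem_union_left _ (Finset.mem_union_left _ hk)
  exact Full.merge h1 (isCycleOn_swap_mul_of_notMem hC hjC hkC)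
    (Finset.disjoint_union_left.2 ⟨hAC, hBC⟩) hS (support_swap_mul_subset hv hjS hkS)
    (Finset.mem_union_left _ hi) hl

/-- With `k` and `l` both on the side of `i`, `four_swaps` rewrites the double transposition as two
splits followed by two merges: the swap of `k` and `l` cuts `A`, and the last two swaps rejoin the
three pieces. Which alternative holds depends on the piece containing `i`. -/
theorem Full.double_swap_mul_aux {u : Perm α} {A B S : Finset α} (hd : Disjoint A B)
    (hS : A ∪ B = S) {i j k l : α} (hij : i ≠ j) (hik : i ≠ k) (hil : i ≠ l) (hjk : j ≠ k)
    (hjl : j ≠ l) (hkl : k ≠ l) (hi : i ∈ A) (hj : j ∈ B) (hk : k ∈ A) (hl : l ∈ A)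
    (hA : (swap i j * u).IsCycleOn (A : Set α)) (hB : (swap i j * u).IsCycleOn (B : Set α))
    (hu : u.support ⊆ S) :
    Full (swap i k * (swap j l * u)) S ∨ Full (swap i l * (swap j k * u)) S := by
  have hAS : A ⊆ S := hS ▸ Finset.subset_union_left
  have hjS : j ∈ S := hS ▸ Finset.mem_union_right _ hj
  have hkB : k ∉ B := fun h => Finset.disjoint_left.1 hd hk h
  have hlB : l ∉ B := fun h => Finset.disjoint_left.1 hd hl h
  have hw := support_swap_mul_subset (support_swap_mul_subset hu (hAS hi) hjS) (hAS hk) (hAS hl)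
  obtain ⟨C, D, hCD, hU, hkC, hlD, hC, hD⟩ := isCycleOn_split hA hk hl hkl
  have hB' := isCycleOn_swap_mul_of_notMem hB hkB hlB
  subst hU
  obtain ⟨hCB, hDB⟩ := Finset.disjoint_union_left.1 hd
  rcases Finset.mem_union.1 hi with hi | hi
  · left
    rw [← four_swaps hij hik hil hjk hjl hkl]
    exact Full.merge_three hC hB' hD hCB hCD hDB.symm
      (by rw [← hS, Finset.union_right_comm]) hw hi hkC hj hlD
  · right
    rw [← four_swaps hij hil hik hjl hjk hkl.symm, swap_comm l k]
    exact Full.merge_three hD hB' hC hDB hCD.symm hCB.symm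
      (by rw [← hS, Finset.union_right_comm, Finset.union_comm D C]) hw hi hlD hj hkC

theorem Full.double_swap_mul {u : Perm α} {S : Finset α} (hu : Full u S) {i j k l : α}
    (hij : i ≠ j) (hik : i ≠ k) (hil : i ≠ l) (hjk : j ≠ k) (hjl : j ≠ l) (hkl : k ≠ l)
    (hi : i ∈ S) (hj : j ∈ S) (hk : k ∈ S) (hl : l ∈ S) :
    Full (swap i j * (swap k l * u)) S ∨ Full (swap i k * (swap j l * u)) S ∨
      Full (swap i l * (swap j k * u)) S := by
  obtain ⟨A, B, hd, hAB, hiA, hjB, hA, hB⟩ := hu.split hi hj hij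
  have hs := support_swap_mul_subset hu.2 hi hj
  rw [← hAB] at hk hl
  rcases Finset.mem_union.1 hk with hk | hk <;> rcases Finset.mem_union.1 hl with hl | hl
  · exact Or.inr (Full.double_swap_mul_aux hd hAB hij hik hil hjk hjl hkl hiA hjB hk hl hA hB hu.2)
  · left
    rw [swap_mul_swap_comm hik hil hjk hjl]
    exact Full.merge hA hB hd hAB hs hk hl
  · left
    rw [swap_mul_swap_comm hik hil hjk hjl, swap_comm k l]
    exact Full.merge hA hB hd hAB hs hl hk
  · rw [swap_comm i j] at hA hB
    have := Full.double_swap_mul_aux hd.symm (by rw [Finset.union_comm, hAB]) hij.symm hjk hjl hik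
      hil hkl hjB hiA hk hl hB hA hu.2
    rw [swap_mul_swap_comm hij.symm hjl hik.symm hkl,
      swap_mul_swap_comm hij.symm hjk hil.symm hkl.symm] at this
    exact Or.inr this.symm

end

/-! ### The index and its change under a transposition -/

section

variable {α : Type*} [DecidableEq α] [Fintype α]

@[simp] theorem index_one : index (1 : Perm α) = 0 := by simp [index]

theorem index_conj (σ g : Perm α) : index (g * σ * g⁻¹) = index σ := by
  rw [index, index, cycleType_conj]

theorem index_mul {σ τ : Perm α} (h : Perm.Disjoint σ τ) : index (σ * τ) = index σ + index τ := by
  rw [index, h.cycleType_mul, Multiset.map_add, Multiset.sum_add, index, index]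

theorem sum_map_sub_one_add_card (m : Multiset ℕ) (hm : ∀ k ∈ m, 2 ≤ k) :
    (m.map fun k => k - 1).sum + m.card = m.sum := by
  induction m using Multiset.induction_on with
  | empty => simp
  | cons a m ih =>
    have h1 := ih fun k hk => hm k (Multiset.mem_cons_of_mem hk)
    have h2 := hm a (Multiset.mem_cons_self a m)
    simp only [Multiset.map_cons, Multiset.sum_cons, Multiset.card_cons]
    omega

theorem index_add_card (σ : Perm α) : index σ + σ.cycleType.card = σ.support.card := by
  rw [← sum_cycleType]
  exact sum_map_sub_one_add_card _ fun k hk => two_le_of_mem_cycleType hk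

theorem two_mul_card_cycleType_le (σ : Perm α) : 2 * σ.cycleType.card ≤ σ.support.card := by
  rw [← sum_cycleType, mul_comm]
  exact Multiset.card_nsmul_le_sum fun k hk => two_le_of_mem_cycleType hk

theorem card_support_le_two_mul_index (σ : Perm α) : σ.support.card ≤ 2 * index σ := by
  have h1 := index_add_card σ
  have h2 := two_mul_card_cycleType_le σ
  omega

theorem sign_eq_neg_one_pow_index (σ : Perm α) : Perm.sign σ = (-1) ^ index σ := by
  rw [sign_of_cycleType, sum_cycleType, ← index_add_card, add_assoc, ← two_mul, pow_add, pow_mul]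
  simp

theorem index_add_one_le {σ : Perm α} {K : Finset α} (h : σ.support ⊆ K) (hK : K.Nonempty) :
    index σ + 1 ≤ K.card := by
  by_cases h1 : σ = 1
  · simpa [h1] using hK.card_pos
  · have h2 := card_cycleType_pos.2 h1
    have h3 := index_add_card σ
    have h4 := Finset.card_le_card h
    omega

/-- The index is the number of moved points minus the number of nontrivial cycles, so the value |S|
- 1 leaves room for only one cycle. -/
theorem full_of_card_le {σ : Perm α} {S : Finset α} (h : σ.support ⊆ S)
    (hi : S.card ≤ index σ + 1) : Full σ S := by
  by_cases h1 : σ = 1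
  · subst h1
    refine ⟨?_, h⟩
    rw [isCycleOn_one]
    exact Finset.card_le_one_iff_subsingleton.1 (by simpa using hi)
  · have h2 := card_cycleType_pos.2 h1
    have h3 := index_add_card σ
    have h4 := Finset.card_le_card h
    have h5 : σ.support = S := Finset.eq_of_subset_of_card_le h (by omega)
    have h6 : σ.IsCycle := card_cycleType_eq_one.1 (by omega)
    refine ⟨?_, h⟩
    convert! h6.isCycleOn using 1
    ext z
    simp [← h5]

theorem Full.cycleType {f : Perm α} {S : Finset α} (h : Full f S) (hS : 1 < S.card) :
    f.cycleType = {S.card} := by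
  obtain ⟨h1, h2⟩ := h.isCycle hS
  rw [h1.cycleType, h2]

theorem Full.index {f : Perm α} {S : Finset α} (h : Full f S) (hS : 1 < S.card) :
    index f + 1 = S.card := by
  rw [PermOrders.index, h.cycleType hS]
  simp
  omega

theorem two_mul_index_le_of_mul_self {σ : Perm α} (h : ∀ x, σ (σ x) = x) :
    2 * index σ ≤ σ.support.card := by
  have h1 : σ ^ 2 = 1 := by
    ext x
    simp [pow_two, h]
  have : Fact (Nat.Prime 2) := ⟨Nat.prime_two⟩
  have h2 := cycleType_of_pow_prime_eq_one h1
  have h3 := sum_cycleType σ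
  have h4 := index_add_card σ
  rw [h2] at h3
  simp at h3
  omega

theorem exists_restrict {w : Perm α} {K : Finset α} (h : ∀ z, w z ∈ K ↔ z ∈ K) :
    ∃ f ρ : Perm α, w = f * ρ ∧ f.support ⊆ K ∧ (∀ z ∈ K, ρ z = z) ∧ ∀ z ∈ K, f z = w z := by
  have h1 : ∀ z ∈ K, ofSubtype (w.subtypePerm h) z = w z := fun z hz => by
    rw [ofSubtype_apply_of_mem _ hz]; rfl
  refine ⟨ofSubtype (w.subtypePerm h), (ofSubtype (w.subtypePerm h))⁻¹ * w, by simp, ?_, ?_, h1⟩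
  · intro z hz
    by_contra hzK
    exact mem_support.1 hz (ofSubtype_apply_of_not_mem _ hzK)
  · intro z hz
    rw [Perm.mul_apply, ← h1 z hz]
    simp

theorem index_mul_of_support {f ρ : Perm α} {K : Finset α} (hf : f.support ⊆ K)
    (hρ : ∀ z ∈ K, ρ z = z) : index (f * ρ) = index f + index ρ := by
  refine index_mul fun z => ?_
  by_cases hz : z ∈ K
  · exact Or.inr (hρ z hz)
  · exact Or.inl (by by_contra h; exact hz (hf (mem_support.2 h)))

theorem Full.card_le_index {f : Perm α} {S : Finset α} (h : Full f S) :
    S.card ≤ PermOrders.index f + 1 := by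
  rcases Nat.lt_or_ge 1 S.card with h1 | h1
  · exact (h.index h1).ge
  · omega

theorem exists_orbit (w : Perm α) (x : α) : ∃ K : Finset α, x ∈ K ∧ (∀ z, w z ∈ K ↔ z ∈ K) ∧
    w.IsCycleOn (K : Set α) ∧ ∀ z, z ∈ K ↔ w.SameCycle x z := by
  classical
  refine ⟨Finset.univ.filter fun z => w.SameCycle x z, by simp [SameCycle.rfl], by simp,
    ⟨Equiv.bijOn _ (by simp), fun z hz u hu => ?_⟩, by simp⟩
  simp only [Finset.coe_filter, Finset.mem_univ, true_and, Set.mem_ofPred_eq] at hz hu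
  exact hz.symm.trans hu

/-- Only the cycles through `x` and `y` are affected. On their union K the new index is at most |K|
- 1, while the old one is |K| - 1 or |K| - 2 according as they coincide or not. -/
theorem index_swap_mul_le (w : Perm α) (x y : α) :
    index (swap x y * w) ≤ index w + 1 := by
  obtain ⟨A, hxA, hA, hAc, hAx⟩ := exists_orbit w x
  obtain ⟨f, ρ, hw, hf, hρ, hfw⟩ := exists_restrict hA
  have hfull : Full f A := ⟨isCycleOn_congr hAc fun z hz => (hfw z hz).symm, hf⟩
  have h1 := hfull.card_le_index
  by_cases hyA : y ∈ A
  · have h2 := support_swap_mul_subset hf hxA hyA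
    have h3 := index_add_one_le h2 ⟨x, hxA⟩
    rw [hw, ← mul_assoc, index_mul_of_support h2 hρ, index_mul_of_support hf hρ]
    omega
  · obtain ⟨B, hyB, hB, hBc, hBy⟩ := exists_orbit w y
    have hAB : Disjoint A B := by
      rw [Finset.disjoint_left]
      intro z hz hz'
      exact hyA ((hAx y).2 (((hAx z).1 hz).trans ((hBy z).1 hz').symm))
    have hρw : ∀ z ∈ B, w z = ρ z := by
      intro z hz
      have h2 : w z ∉ A := fun h => Finset.disjoint_left.1 hAB h ((hB z).2 hz)
      have h3 : f⁻¹ (w z) = w z := by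
        by_contra h
        have : w z ∈ f.support := by
          rw [← support_inv, mem_support]; exact h
        exact h2 (hf this)
      rw [← h3, hw]
      simp
    have hB' : ∀ z, ρ z ∈ B ↔ z ∈ B := by
      intro z
      by_cases hzA : z ∈ A
      · rw [hρ z hzA]
      · constructor
        · intro h
          have h4 : w.symm (ρ z) ∈ B := (hB _).1 (by simpa using h)
          have h5 := hρw _ h4
          rw [Equiv.apply_symm_apply] at h5
          rwa [ρ.injective h5]
        · intro h
          rw [← hρw z h]
          exact (hB z).2 h
    obtain ⟨f', ρ', hw', hf', hρ', hfw'⟩ := exists_restrict hB'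
    have hfull' : Full f' B :=
      ⟨isCycleOn_congr hBc fun z hz => (hρw z hz).trans (hfw' z hz).symm, hf'⟩
    have h2 := hfull'.card_le_index
    have h5 : ∀ z ∈ A, f' z = z := fun z hz => by
      by_contra h
      exact Finset.disjoint_left.1 hAB hz (hf' (mem_support.2 h))
    have h6 : ∀ z ∈ A ∪ B, ρ' z = z := by
      intro z hz
      rcases Finset.mem_union.1 hz with hz | hz
      · have h7 := hρ z hz
        rw [hw', Perm.mul_apply] at h7
        exact f'.injective (h7.trans (h5 z hz).symm)
      · exact hρ' z hz
    have h7 : (f * f').support ⊆ A ∪ B :=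
      (support_mul_le f f').trans (Finset.union_subset_union hf hf')
    have h8 := support_swap_mul_subset h7 (Finset.mem_union_left B hxA)
      (Finset.mem_union_right A hyB)
    have h9 := index_add_one_le h8 ⟨x, Finset.mem_union_left B hxA⟩
    rw [Finset.card_union_of_disjoint hAB] at h9
    rw [hw, hw', ← mul_assoc f, ← mul_assoc (swap x y), index_mul_of_support h8 h6,
      index_mul_of_support h7 h6, index_mul_of_support hf h5]
    omega

theorem index_le_index_swap_mul (w : Perm α) (x y : α) :
    index w ≤ index (swap x y * w) + 1 := by
  simpa [← mul_assoc] using index_swap_mul_le (swap x y * w) x y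

end

/-! ### Reductions for joining two classes into a full cycle -/

section

variable {α : Type*} [DecidableEq α]

theorem swap_conj_eq {ρ : Perm α} {x y : α} (hx : ρ x = x) (hy : ρ y = y) :
    swap x y * ρ * (swap x y)⁻¹ = ρ := by
  rw [mul_inv_eq_iff_eq_mul, mul_swap_eq_swap_mul, hx, hy]

variable [Fintype α]

/-- Some conjugate of `τ` by a permutation of `S` taking the mark `t` to the mark `s` has a product
with `σ` that is a full cycle on `S`. -/
def Joinable (S : Finset α) (σ τ : Perm α) (s t : α) : Prop :=
  ∃ g : Perm α, g.support ⊆ S ∧ g t = s ∧ Full (σ * (g * τ * g⁻¹)) S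

theorem support_conj_subset {u g : Perm α} {S : Finset α} (hu : u.support ⊆ S)
    (hg : g.support ⊆ S) : (g * u * g⁻¹).support ⊆ S :=
  (support_mul_le _ _).trans (sup_le ((support_mul_le _ _).trans (sup_le hg hu))
    (by rwa [support_inv]))

theorem support_subset_erase {u : Perm α} {S : Finset α} (hu : u.support ⊆ S) {f : α}
    (hf : u f = f) : u.support ⊆ S.erase f := fun _ hz =>
  Finset.mem_erase.2 ⟨fun h => mem_support.1 hz (h ▸ hf), hu hz⟩

theorem apply_eq_self_of_notMem {u : Perm α} {S : Finset α} (hu : u.support ⊆ S) {z : α}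
    (hz : z ∉ S) : u z = z := by
  by_contra h
  exact hz (hu (mem_support.2 h))

theorem support_swap_subset {S : Finset α} {x y : α} (hx : x ∈ S) (hy : y ∈ S) :
    (swap x y).support ⊆ S := by
  simpa using support_swap_mul_subset (f := 1) (by simp) hx hy

theorem sign_conj_eq (h τ : Perm α) : Perm.sign (h * τ * h⁻¹) = Perm.sign τ := by
  rw [Perm.sign_mul, Perm.sign_mul, mul_right_comm, ← Perm.sign_mul]
  simp

theorem Full.insert {u : Perm α} {S : Finset α} {f y : α} (hu : Full u (S.erase f)) (hf : f ∈ S)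
    (hy : y ∈ S) (hyf : y ≠ f) : Full (swap f y * u) S := by
  have h1 : u f = f := apply_eq_self_of_notMem hu.2 (by simp)
  refine Full.merge (A := {f}) (by simpa [isCycleOn_singleton] using h1) hu.1 (by simp)
    (by simp [Finset.insert_erase hf]) (hu.2.trans (Finset.erase_subset _ _)) (by simp)
    (Finset.mem_erase.2 ⟨hyf, hy⟩)

theorem Joinable.of_conj_right {S : Finset α} {σ τ h : Perm α} {s t : α} (hh : h.support ⊆ S)
    (H : Joinable S σ (h * τ * h⁻¹) s (h t)) : Joinable S σ τ s t := by
  obtain ⟨g, hg, hgt, hfull⟩ := H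
  refine ⟨g * h, (support_mul_le _ _).trans (sup_le hg hh), hgt, ?_⟩
  convert! hfull using 2

theorem Joinable.of_conj_left {S : Finset α} {σ τ h : Perm α} {s t : α} (hh : h.support ⊆ S)
    (H : Joinable S (h * σ * h⁻¹) τ (h s) t) : Joinable S σ τ s t := by
  obtain ⟨g, hg, hgt, hfull⟩ := H
  have hh' : h⁻¹.support ⊆ S := by rwa [support_inv]
  refine ⟨h⁻¹ * g, (support_mul_le _ _).trans (sup_le hh' hg), by simp [hgt], ?_⟩
  convert! hfull.conj hh' using 1
  group

theorem Joinable.of_delete_left {S : Finset α} {σ τ : Perm α} {s t f : α} (hσ : σ.support ⊆ S)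
    (hf : σ f ≠ f) (H : Joinable (S.erase f) (swap f (σ f) * σ) τ s t) : Joinable S σ τ s t := by
  obtain ⟨g, hg, hgt, hfull⟩ := H
  refine ⟨g, hg.trans (Finset.erase_subset _ _), hgt, ?_⟩
  have hfS : f ∈ S := hσ (mem_support.2 hf)
  have h1 := hfull.insert hfS ((apply_mem_iff_of_support_subset hσ f).2 hfS) hf
  simpa [← mul_assoc] using h1

/-- Since `σ` and `g` fix `f`, the transposition restoring `f` to the cycle of `τ` can be carried to
the far left of the product, where it inserts `f` into the full cycle. -/
theorem Joinable.of_delete_right {S : Finset α} {σ τ : Perm α} {s t f : α} (hσ : σ.support ⊆ S)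
    (hτ : τ.support ⊆ S) (hσf : σ f = f) (hf : τ f ≠ f)
    (H : Joinable (S.erase f) σ (swap f (τ f) * τ) s t) : Joinable S σ τ s t := by
  obtain ⟨g, hg, hgt, hfull⟩ := H
  have hgS := hg.trans (Finset.erase_subset f S)
  refine ⟨g, hgS, hgt, ?_⟩
  have hfS : f ∈ S := hτ (mem_support.2 hf)
  have hgf : g f = f := apply_eq_self_of_notMem hg (by simp)
  have h2 : σ (g (τ f)) ∈ S := by
    rw [apply_mem_iff_of_support_subset hσ, apply_mem_iff_of_support_subset hgS,
      apply_mem_iff_of_support_subset hτ]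
    exact hfS
  have h3 : σ (g (τ f)) ≠ f := by
    intro h
    have h4 : g (τ f) = f := σ.injective (h.trans hσf.symm)
    exact hf (g.injective (h4.trans hgf.symm))
  have h1 := hfull.insert hfS h2 h3
  have h5 : swap f (σ (g (τ f))) * σ = σ * (g * swap f (τ f) * g⁻¹) := by
    rw [mul_swap_eq_swap_mul, hgf, mul_assoc (swap f _), mul_inv_cancel, mul_one,
      mul_swap_eq_swap_mul, hσf]
  rw [← mul_assoc, h5] at h1
  convert! h1 using 1
  have h6 : swap f (τ f) * (swap f (τ f) * τ) = τ := by simp [← mul_assoc]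
  conv_lhs => rw [← h6]
  group

/-- One of the two 3-cycles on `i`, `j`, `k` keeps the product full; swapping `i` and `j` exchanges
them without disturbing `ρ` or the mark `s`. -/
theorem Joinable.of_three {S : Finset α} {σ ρ τ : Perm α} {s t i j k : α} (hi : i ∈ S) (hj : j ∈ S)
    (hk : k ∈ S) (hij : i ≠ j) (hik : i ≠ k) (hjk : j ≠ k) (hsi : s ≠ i) (hsj : s ≠ j)
    (hρi : ρ i = i) (hρj : ρ j = j) (hσ : σ = swap i j * (swap j k * ρ))
    (H : Joinable S ρ τ s t) : Joinable S σ τ s t := by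
  obtain ⟨g, hg, hgt, hfull⟩ := H
  rcases hfull.three_cycle_mul hj hk hi hjk with h | h
  · refine ⟨g, hg, hgt, ?_⟩
    rw [hσ]
    convert! h using 1
  · refine Joinable.of_conj_left (h := swap i j) (support_swap_subset hi hj)
      ⟨g, hg, by rw [swap_apply_of_ne_of_ne hsi hsj, hgt], ?_⟩
    have h1 : swap i j * σ * (swap i j)⁻¹ = swap i k * (swap j k * ρ) := by
      have h2 : swap i j * (swap i j * swap j k) * (swap i j)⁻¹ = swap i k * swap j k := by
        ext z
        simp only [Perm.mul_apply, swap_apply_def, swap_inv]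
        grind
      calc swap i j * σ * (swap i j)⁻¹
          = swap i j * (swap i j * swap j k) * (swap i j)⁻¹ *
            (swap i j * ρ * (swap i j)⁻¹) := by rw [hσ]; simp [mul_assoc]
        _ = swap i k * (swap j k * ρ) := by rw [h2, swap_conj_eq hρi hρj, mul_assoc]
    rw [h1]
    convert! h using 1

/-- One of the three pairings of the four points keeps the product full, and all three are conjugate
by swaps fixing `s` and commuting with `ρ`. -/
theorem Joinable.of_double {S : Finset α} {σ ρ τ : Perm α} {s t i j k l : α} (hij : i ≠ j)
    (hik : i ≠ k) (hil : i ≠ l) (hjk : j ≠ k) (hjl : j ≠ l) (hkl : k ≠ l)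
    (hi : i ∈ S) (hj : j ∈ S) (hk : k ∈ S) (hl : l ∈ S) (hsj : s ≠ j) (hsk : s ≠ k) (hsl : s ≠ l)
    (hρj : ρ j = j) (hρk : ρ k = k) (hρl : ρ l = l) (hσ : σ = swap i j * (swap k l * ρ))
    (H : Joinable S ρ τ s t) : Joinable S σ τ s t := by
  obtain ⟨g, hg, hgt, hfull⟩ := H
  rcases hfull.double_swap_mul hij hik hil hjk hjl hkl hi hj hk hl with h | h | h
  · refine ⟨g, hg, hgt, ?_⟩
    rw [hσ]
    convert! h using 1
  · refine Joinable.of_conj_left (h := swap j k) (support_swap_subset hj hk)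
      ⟨g, hg, by rw [swap_apply_of_ne_of_ne hsj hsk, hgt], ?_⟩
    have h2 : swap j k * (swap i j * swap k l) * (swap j k)⁻¹ = swap i k * swap j l := by
      ext z
      simp only [Perm.mul_apply, swap_apply_def, swap_inv]
      grind
    have h1 : swap j k * σ * (swap j k)⁻¹ = swap i k * (swap j l * ρ) := by
      calc swap j k * σ * (swap j k)⁻¹
          = swap j k * (swap i j * swap k l) * (swap j k)⁻¹ *
            (swap j k * ρ * (swap j k)⁻¹) := by rw [hσ]; simp [mul_assoc]
        _ = swap i k * (swap j l * ρ) := by rw [h2, swap_conj_eq hρj hρk, mul_assoc]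
    rw [h1]
    convert! h using 1
  · refine Joinable.of_conj_left (h := swap j l) (support_swap_subset hj hl)
      ⟨g, hg, by rw [swap_apply_of_ne_of_ne hsj hsl, hgt], ?_⟩
    have h2 : swap j l * (swap i j * swap k l) * (swap j l)⁻¹ = swap i l * swap j k := by
      ext z
      simp only [Perm.mul_apply, swap_apply_def, swap_inv]
      grind
    have h1 : swap j l * σ * (swap j l)⁻¹ = swap i l * (swap j k * ρ) := by
      calc swap j l * σ * (swap j l)⁻¹
          = swap j l * (swap i j * swap k l) * (swap j l)⁻¹ *
            (swap j l * ρ * (swap j l)⁻¹) := by rw [hσ]; simp [mul_assoc]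
        _ = swap i l * (swap j k * ρ) := by rw [h2, swap_conj_eq hρj hρl, mul_assoc]
    rw [h1]
    convert! h using 1

end

/-! ### The joining lemma -/

section

variable {α : Type*} [DecidableEq α] [Fintype α]

theorem sign_swap_mul {x y : α} (h : x ≠ y) (σ : Perm α) :
    Perm.sign (swap x y * σ) = -Perm.sign σ := by
  rw [Perm.sign_mul, sign_swap h, neg_one_mul]

theorem index_add_mod_two {S : Finset α} {σ τ : Perm α}
    (hs : Perm.sign σ * Perm.sign τ = (-1) ^ (S.card + 1)) :
    (index σ + index τ) % 2 = (S.card + 1) % 2 := by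
  rw [sign_eq_neg_one_pow_index, sign_eq_neg_one_pow_index, ← pow_add] at hs
  rcases Nat.even_or_odd (index σ + index τ) with h1 | h1 <;>
    rcases Nat.even_or_odd (S.card + 1) with h2 | h2
  · rw [Nat.even_iff.1 h1, Nat.even_iff.1 h2]
  · rw [h1.neg_one_pow, h2.neg_one_pow] at hs
    exact absurd hs (by decide)
  · rw [h1.neg_one_pow, h2.neg_one_pow] at hs
    exact absurd hs (by decide)
  · rw [Nat.odd_iff.1 h1, Nat.odd_iff.1 h2]

/-- Two conjugacy classes of `Sym S` whose indices add up to at least `|S| - 1`, with the right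
parity, contain elements whose product is a full cycle. A cycle of the one may moreover be made to
meet a given nontrivial cycle of the other. -/
theorem joinable (N : ℕ) : ∀ (S : Finset α) (σ τ : Perm α) (s t : α),
    S.card + σ.support.card ≤ N → σ.support ⊆ S → τ.support ⊆ S → s ∈ S → τ t ≠ t →
    S.card ≤ index σ + index τ + 1 → Perm.sign σ * Perm.sign τ = (-1) ^ (S.card + 1) →
    Joinable S σ τ s t := by
  induction N with
  | zero =>
    intro S σ τ s t hN _ _ hs
    have := Finset.card_pos.2 ⟨s, hs⟩
    omega
  | succ N ih =>
    intro S σ τ s t hN hσ hτ hs ht hi hsgn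
    have htS : t ∈ S := hτ (mem_support.2 ht)
    by_cases hσ1 : σ = 1
    · subst hσ1
      have h1 : Full τ S := full_of_card_le hτ (by simpa using hi)
      refine ⟨swap t s, support_swap_subset htS hs, swap_apply_left _ _, ?_⟩
      rw [one_mul]
      exact h1.conj (support_swap_subset htS hs)
    have hσne : σ.support.Nonempty :=
      Finset.nonempty_iff_ne_empty.2 (mt support_eq_empty_iff.1 hσ1)
    have hstep : ∀ f ∈ S, ∀ u v : Perm α, u f ≠ f →
        Perm.sign u * Perm.sign v = (-1) ^ (S.card + 1) →
        Perm.sign (swap f (u f) * u) * Perm.sign v = (-1) ^ ((S.erase f).card + 1) := by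
      intro f hf u v hu h
      rw [sign_swap_mul hu.symm, neg_mul, h, ← Finset.card_erase_add_one hf, pow_succ _ (_ + 1)]
      simp
    by_cases hfτ : ∃ f ∈ S, τ f = f
    · obtain ⟨f₀, hf₀, hτf₀⟩ := hfτ
      -- A fixed point of `τ` is moved onto `f`, and `f` is then deleted from `σ`; keeping `f ≠ s`
      -- preserves the mark.
      obtain ⟨f, hf, hfs⟩ : ∃ f, σ f ≠ f ∧ f ≠ s := by
        obtain ⟨x, hx⟩ := hσne
        rw [mem_support] at hx
        by_cases hxs : x = s
        · exact ⟨σ x, fun h => hx (σ.injective h), fun h => hx (h.trans hxs.symm)⟩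
        · exact ⟨x, hx, hxs⟩
      have hfS : f ∈ S := hσ (mem_support.2 hf)
      have hh := support_swap_subset hfS hf₀
      have hcard := Finset.card_erase_add_one hfS
      refine Joinable.of_conj_right hh (Joinable.of_delete_left hσ hf ?_)
      have hsub : (swap f (σ f) * σ).support ⊆ S.erase f :=
        support_subset_erase (support_swap_mul_subset hσ hfS
          ((apply_mem_iff_of_support_subset hσ f).2 hfS)) (by simp)
      have hle : (swap f (σ f) * σ).support.card ≤ σ.support.card :=
        (card_support_swap_mul hf).le
      refine ih _ _ _ _ _ (by omega) hsub ?_ (Finset.mem_erase.2 ⟨hfs.symm, hs⟩) ?_ ?_ ?_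
      · refine support_subset_erase (support_conj_subset hτ hh) ?_
        simp [hτf₀]
      · simpa using ht
      · have := index_le_index_swap_mul σ f (σ f)
        rw [index_conj]
        omega
      · exact hstep f hfS _ _ hf (by rwa [sign_conj_eq])
    push Not at hfτ
    by_cases hfσ : ∃ f ∈ S, f ≠ s ∧ σ f = f
    · obtain ⟨f₀, hf₀, hf₀s, hσf₀⟩ := hfσ
      -- Deleting `f` from `τ` must leave `t` moved, so `f` may not be the partner of `t` in a
      -- 2-cycle.
      obtain ⟨f, hfS, hft, hf'⟩ : ∃ f ∈ S, f ≠ t ∧ (f ≠ τ t ∨ τ (τ t) ≠ t) := by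
        by_cases h : τ (τ t) = t
        · have h3 : 2 < S.card := by
            obtain ⟨x, hx⟩ := hσne
            have hxS := hσ hx
            have hσx := hσ (apply_mem_support.2 hx)
            rw [mem_support] at hx
            rw [Finset.two_lt_card]
            refine ⟨x, hxS, σ x, hσx, f₀, hf₀, hx.symm, ?_, ?_⟩
            · rintro rfl; exact hx hσf₀
            · intro h4
              exact hx (by rw [σ.injective (h4.trans hσf₀.symm), hσf₀])
          have h4 : ({t, τ t} : Finset α).card < S.card :=
            (Finset.card_le_two).trans_lt h3
          obtain ⟨f, hf, hf2⟩ := Finset.exists_mem_notMem_of_card_lt_card h4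
          simp only [Finset.mem_insert, Finset.mem_singleton, not_or] at hf2
          exact ⟨f, hf, hf2.1, Or.inl hf2.2⟩
        · exact ⟨τ t, (apply_mem_iff_of_support_subset hτ t).2 htS, ht, Or.inr h⟩
      have hf : τ f ≠ f := hfτ f hfS
      have hh := support_swap_subset hfS hf₀
      have hcard := Finset.card_erase_add_one hfS
      refine Joinable.of_conj_left hh (Joinable.of_delete_right (f := f)
        (support_conj_subset hσ hh) hτ (by simp [hσf₀]) hf ?_)
      have hsub : (swap f (τ f) * τ).support ⊆ S.erase f :=
        support_subset_erase (support_swap_mul_subset hτ hfS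
          ((apply_mem_iff_of_support_subset hτ f).2 hfS)) (by simp)
      refine ih _ _ _ _ _ ?_ ?_ hsub ?_ ?_ ?_ ?_
      · have : (swap f f₀ * σ * (swap f f₀)⁻¹).support.card = σ.support.card :=
          card_support_conj
        omega
      · refine support_subset_erase (support_conj_subset hσ hh) ?_
        simp [hσf₀]
      · refine Finset.mem_erase.2 ⟨?_, (apply_mem_iff_of_support_subset hh s).2 hs⟩
        intro h
        rw [swap_apply_eq_iff, swap_apply_left] at h
        exact hf₀s h.symm
      · rw [Perm.mul_apply, swap_apply_def]
        have := τ.injective.eq_iff (a := t) (b := f)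
        grind
      · have := index_le_index_swap_mul τ f (τ f)
        rw [index_conj]
        omega
      · rw [mul_comm]
        exact hstep f hfS _ _ hf (by rwa [mul_comm, sign_conj_eq])
    push Not at hfσ
    have hpar := index_add_mod_two hsgn
    have hτS : τ.support = S :=
      hτ.antisymm fun z hz => mem_support.2 (hfτ z hz)
    have hσS : S.card ≤ σ.support.card + 1 := by
      have h1 : S.erase s ⊆ σ.support := fun z hz =>
        mem_support.2 (hfσ z (Finset.mem_of_mem_erase hz) (Finset.ne_of_mem_erase hz))
      have h2 := Finset.card_le_card h1
      have h3 := Finset.card_erase_add_one hs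
      omega
    have h1 := card_support_le_two_mul_index σ
    have h2 := card_support_le_two_mul_index τ
    rw [hτS] at h2
    -- With almost no fixed points the index sum is at least |S|, and parity excludes equality. The
    -- slack of two pays for removing a 3-cycle or two transpositions from `σ`.
    have hge : S.card + 1 ≤ index σ + index τ := by omega
    have hτlt := index_add_one_le hτ ⟨s, hs⟩
    by_cases hinv : ∀ x, σ (σ x) = x
    · have h3 := two_mul_index_le_of_mul_self hinv
      have h4 := Finset.card_le_card hσ
      have hcard : 4 ≤ S.card := by omega
      -- Of the four points to be used, only `i` may be the mark, since the conjugations in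
      -- `Joinable.of_double` fix `i`.
      obtain ⟨i, hiS, hi1, his⟩ : ∃ i ∈ S, σ i ≠ i ∧ (i = s ∨ σ s = s) := by
        by_cases h : σ s = s
        · obtain ⟨x, hx⟩ := hσne
          exact ⟨x, hσ hx, mem_support.1 hx, Or.inr h⟩
        · exact ⟨s, hs, h, Or.inl rfl⟩
      obtain ⟨k, hkS, hk⟩ : ∃ k ∈ S, k ∉ ({i, σ i, s} : Finset α) :=
        Finset.exists_mem_notMem_of_card_lt_card ((Finset.card_le_three).trans_lt hcard)
      simp only [Finset.mem_insert, Finset.mem_singleton, not_or] at hk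
      have hk1 : σ k ≠ k := hfσ k hkS hk.2.2
      have inj := fun a b => σ.injective.eq_iff (a := a) (b := b)
      have hSσ : ∀ z ∈ S, σ z ∈ S := fun z => (apply_mem_iff_of_support_subset hσ z).2
      have hii := hinv i
      have hkk := hinv k
      set ρ := swap k (σ k) * (swap i (σ i) * σ) with hρ
      have hρz : ∀ z, ρ z = swap k (σ k) (swap i (σ i) (σ z)) := fun z => rfl
      have hρi : ρ i = i := by rw [hρz]; simp only [swap_apply_def]; grind
      have hρj : ρ (σ i) = σ i := by rw [hρz]; simp only [swap_apply_def]; grind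
      have hρk : ρ k = k := by rw [hρz]; simp only [swap_apply_def]; grind
      have hρl : ρ (σ k) = σ k := by rw [hρz]; simp only [swap_apply_def]; grind
      have hik : i ≠ σ k := by grind
      have hjl : σ i ≠ σ k := by grind
      have hsub : ρ.support ⊆ S := support_swap_mul_subset (support_swap_mul_subset hσ hiS
        (hSσ i hiS)) hkS (hSσ k hkS)
      refine Joinable.of_double (ρ := ρ) hi1.symm (Ne.symm hk.1) hik (Ne.symm hk.2.1) hjl hk1.symm
        hiS (hSσ i hiS) hkS (hSσ k hkS) (by grind) (Ne.symm hk.2.2) (by grind) hρj hρk hρl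
        (by simp [hρ, ← mul_assoc]) ?_
      have hlt : ρ.support.card < σ.support.card := by
        refine Finset.card_lt_card ⟨fun z hz => ?_, fun h => ?_⟩
        · by_contra hz'
          rw [notMem_support] at hz'
          refine mem_support.1 hz ?_
          rw [hρz]
          simp only [swap_apply_def]
          grind
        · exact mem_support.1 (h (mem_support.2 hi1)) hρi
      refine ih _ _ _ _ _ (by omega) hsub hτ hs ht ?_ ?_
      · have h5 := index_le_index_swap_mul σ i (σ i)
        have h6 := index_le_index_swap_mul (swap i (σ i) * σ) k (σ k)
        rw [← hρ] at h6
        omega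
      · rw [hρ, sign_swap_mul hk1.symm, sign_swap_mul hi1.symm, neg_neg, hsgn]
    · push Not at hinv
      obtain ⟨i, hi1, hi2, his, hjs⟩ : ∃ i, σ i ≠ i ∧ σ (σ i) ≠ i ∧ i ≠ s ∧ σ i ≠ s := by
        obtain ⟨x, hx⟩ := hinv
        have inj := fun a b => σ.injective.eq_iff (a := a) (b := b)
        have hx1 : σ x ≠ x := by grind
        by_cases h1 : x = s
        · exact ⟨σ x, by grind, by grind, by grind, by grind⟩
        · by_cases h2 : σ x = s
          · exact ⟨σ (σ x), by grind, by grind, by grind, by grind⟩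
          · exact ⟨x, hx1, hx, h1, h2⟩
      have inj := fun a b => σ.injective.eq_iff (a := a) (b := b)
      have hSσ : ∀ z ∈ S, σ z ∈ S := fun z => (apply_mem_iff_of_support_subset hσ z).2
      have hiS : i ∈ S := hσ (mem_support.2 hi1)
      have hj1 : σ i ≠ σ (σ i) := by grind
      set ρ := swap (σ i) (σ (σ i)) * (swap i (σ i) * σ) with hρ
      have hρz : ∀ z, ρ z = swap (σ i) (σ (σ i)) (swap i (σ i) (σ z)) := fun z => rfl
      have hρi : ρ i = i := by rw [hρz]; simp only [swap_apply_def]; grind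
      have hρj : ρ (σ i) = σ i := by rw [hρz]; simp only [swap_apply_def]; grind
      have hsub : ρ.support ⊆ S := support_swap_mul_subset (support_swap_mul_subset hσ hiS
        (hSσ i hiS)) (hSσ _ hiS) (hSσ _ (hSσ i hiS))
      refine Joinable.of_three (ρ := ρ) hiS (hSσ i hiS) (hSσ _ (hSσ i hiS)) hi1.symm hi2.symm hj1
        his.symm hjs.symm hρi hρj (by simp [hρ, ← mul_assoc]) ?_
      have hlt : ρ.support.card < σ.support.card := by
        refine Finset.card_lt_card ⟨fun z hz => ?_, fun h => ?_⟩
        · by_contra hz'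
          rw [notMem_support] at hz'
          refine mem_support.1 hz ?_
          rw [hρz]
          simp only [swap_apply_def]
          grind
        · exact mem_support.1 (h (mem_support.2 hi1)) hρi
      refine ih _ _ _ _ _ (by omega) hsub hτ hs ht ?_ ?_
      · have h5 := index_le_index_swap_mul σ i (σ i)
        have h6 := index_le_index_swap_mul (swap i (σ i) * σ) (σ i) (σ (σ i))
        rw [← hρ] at h6
        omega
      · rw [hρ, sign_swap_mul hj1, sign_swap_mul hi1.symm, neg_neg, hsgn]

end

section

/-! ### Products with prescribed orders -/

section Realizes

variable {G : Type*} [Group G]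

/-- `g` is a product of elements whose orders are, in order, the entries of `l`. -/
def Realizes (l : List ℕ) (g : G) : Prop :=
  ∃ xs : List G, xs.map orderOf = l ∧ xs.prod = g

theorem realizes_nil : Realizes [] (1 : G) := ⟨[], rfl, rfl⟩

theorem Realizes.cons {l : List ℕ} {g : G} (h : Realizes l g) (x : G) :
    Realizes (orderOf x :: l) (x * g) := by
  obtain ⟨xs, h1, h2⟩ := h
  exact ⟨x :: xs, by simp [h1], by simp [h2]⟩

theorem realizes_singleton (x : G) : Realizes [orderOf x] x := by
  simpa using realizes_nil.cons x

theorem Realizes.orderOf_eq {a : ℕ} {g : G} (h : Realizes [a] g) : orderOf g = a := by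
  obtain ⟨xs, h1, h2⟩ := h
  obtain ⟨x, rfl, rfl⟩ := List.map_eq_singleton_iff.1 h1
  rw [← h2]
  simp

theorem orderOf_conj_eq (g x : G) : orderOf (g * x * g⁻¹) = orderOf x :=
  orderOf_injective (MulAut.conj g).toMonoidHom (MulAut.conj g).injective x

theorem Realizes.conj {l : List ℕ} {g : G} (h : Realizes l g) (k : G) :
    Realizes l (k * g * k⁻¹) := by
  obtain ⟨xs, h1, h2⟩ := h
  refine ⟨xs.map (MulAut.conj k), ?_, ?_⟩
  · rw [List.map_map, ← h1]
    exact List.map_congr_left fun x _ => orderOf_conj_eq k x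
  · rw [← map_list_prod, h2, MulAut.conj_apply]

/-- Adjacent factors are exchanged by x y = (x y x⁻¹) x. -/
theorem Realizes.perm {l l' : List ℕ} (hl : l.Perm l') : ∀ {g : G}, Realizes l g → Realizes l' g := by
  induction hl with
  | nil => exact id
  | cons a _ ih =>
    rintro _ ⟨xs, h1, rfl⟩
    obtain ⟨x, ys, rfl, rfl, h2⟩ := List.map_eq_cons_iff.1 h1
    rw [List.prod_cons]
    exact (ih ⟨ys, h2, rfl⟩).cons x
  | swap a b l =>
    rintro _ ⟨xs, h1, rfl⟩
    obtain ⟨x, ys, rfl, rfl, h2⟩ := List.map_eq_cons_iff.1 h1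
    obtain ⟨y, zs, rfl, rfl, h3⟩ := List.map_eq_cons_iff.1 h2
    refine ⟨x * y * x⁻¹ :: x :: zs, ?_, by simp [mul_assoc]⟩
    rw [List.map_cons, List.map_cons, orderOf_conj_eq, h3]
  | trans _ _ ih1 ih2 => exact fun h => ih2 (ih1 h)

theorem Realizes.complete {l : List ℕ} {g : G} (h : Realizes l g) :
    Realizes (orderOf g :: l) (1 : G) := by
  simpa using h.cons g⁻¹

theorem Realizes.cons_cons_two {l : List ℕ} {g x : G} (h : Realizes l g) (hx : orderOf x = 2) :
    Realizes (2 :: 2 :: l) g := by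
  have h1 : x * x = 1 := by rw [← pow_two, ← hx, pow_orderOf_eq_one]
  have h2 := (h.cons x).cons x
  rwa [← mul_assoc, h1, one_mul, hx] at h2

/-- Write x = x² x⁻¹; squaring preserves an odd order. -/
theorem Realizes.duplicate {l : List ℕ} {g : G} {n : ℕ} (hn : Odd n) (h : Realizes (n :: l) g) :
    Realizes (n :: n :: l) g := by
  obtain ⟨xs, h1, rfl⟩ := h
  obtain ⟨x, ys, rfl, rfl, h2⟩ := List.map_eq_cons_iff.1 h1
  refine ⟨x ^ 2 :: x⁻¹ :: ys, ?_, by simp [pow_two, mul_assoc]⟩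
  have h3 : orderOf (x ^ 2) = orderOf x := by
    rw [Nat.Coprime.orderOf_pow]
    exact Nat.coprime_two_right.2 hn
  simp [h2, h3]

end Realizes

/-! ### Elements of given order and large index -/

variable {α : Type*} [DecidableEq α] [Fintype α]

theorem exists_full_mul_conj {S : Finset α} {σ τ : Perm α} (hS : S.Nonempty) (hσ : σ.support ⊆ S)
    (hτ : τ.support ⊆ S) (hi : S.card ≤ index σ + index τ + 1)
    (hs : Perm.sign σ * Perm.sign τ = (-1) ^ (S.card + 1)) :
    ∃ g : Perm α, g.support ⊆ S ∧ Full (σ * (g * τ * g⁻¹)) S := by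
  by_cases h1 : τ = 1
  · subst h1
    exact ⟨1, by simp, by simpa using full_of_card_le hσ (by simpa using hi)⟩
  · obtain ⟨t, ht⟩ : ∃ t, τ t ≠ t := by
      by_contra! h
      exact h1 (Perm.ext h)
    obtain ⟨s, hs'⟩ := hS
    obtain ⟨g, hg, -, h⟩ := joinable _ S σ τ s t le_rfl hσ hτ hs' ht hi hs
    exact ⟨g, hg, h⟩

theorem exists_cycleType (S : Finset α) (m : Multiset ℕ) (hm : m.sum ≤ S.card)
    (h2 : ∀ k ∈ m, 2 ≤ k) : ∃ σ : Perm α, σ.support ⊆ S ∧ σ.cycleType = m ∧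
      index σ + m.card = m.sum := by
  obtain ⟨g, hg⟩ := (exists_with_cycleType_iff (α := S)).2 ⟨by simpa using hm, h2⟩
  have h1 : (ofSubtype g).cycleType = m := by rw [cycleType_ofSubtype, hg]
  refine ⟨ofSubtype g, fun z hz => ?_, h1, ?_⟩
  · by_contra hzS
    exact mem_support.1 hz (ofSubtype_apply_of_not_mem _ hzS)
  · rw [index, h1, sum_map_sub_one_add_card m h2]

theorem orderOf_eq_of_cycleType {σ : Perm α} {a : ℕ} {m : Multiset ℕ} (h : σ.cycleType = a ::ₘ m)
    (hm : ∀ k ∈ m, k ∣ a) : orderOf σ = a := by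
  rw [← lcm_cycleType, h]
  refine Nat.dvd_antisymm (Multiset.lcm_dvd.2 fun k hk => ?_) (Multiset.dvd_lcm (by simp))
  rcases Multiset.mem_cons.1 hk with rfl | hk
  · exact dvd_rfl
  · exact hm k hk

theorem exists_orderOf (S : Finset α) {a : ℕ} (ha : 2 ≤ a) (haS : a ≤ S.card) :
    ∃ σ : Perm α, σ.support ⊆ S ∧ orderOf σ = a ∧ S.card ≤ 2 * index σ + 1 ∧
      Perm.sign σ = (-1) ^ (S.card / a * (a - 1)) := by
  obtain ⟨σ, hσ, hc, hi⟩ := exists_cycleType S (Multiset.replicate (S.card / a) a)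
    (by simpa using Nat.div_mul_le_self _ _) (fun k hk => by rwa [Multiset.eq_of_mem_replicate hk])
  have hpos : 1 ≤ S.card / a := (Nat.one_le_div_iff (by omega)).2 haS
  obtain ⟨q, hq⟩ := Nat.exists_eq_add_of_le' hpos
  have hidx : index σ = S.card / a * (a - 1) := by
    obtain ⟨b, rfl⟩ := Nat.exists_eq_add_of_le' (show 1 ≤ a by omega)
    simp only [Multiset.card_replicate, Multiset.sum_replicate, smul_eq_mul] at hi
    rw [Nat.add_sub_cancel]
    linarith
  refine ⟨σ, hσ, ?_, ?_, by rw [sign_eq_neg_one_pow_index, hidx]⟩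
  · rw [hq, Multiset.replicate_succ] at hc
    exact orderOf_eq_of_cycleType hc fun k hk => by rw [Multiset.eq_of_mem_replicate hk]
  · have h1 := Nat.div_add_mod S.card a
    have h2 := Nat.mod_lt S.card (show 0 < a by omega)
    obtain ⟨b, rfl⟩ := Nat.exists_eq_add_of_le' ha
    rw [hidx]
    generalize S.card / (b + 2) = d at *
    have : b ≤ d * b := Nat.le_mul_of_pos_left b hpos
    have h3 : b + 2 - 1 = b + 1 := rfl
    rw [h3]
    nlinarith

theorem units_eq_or_neg (a b : ℤˣ) : a = b ∨ a = -b := by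
  rcases Int.units_eq_one_or a with rfl | rfl <;> rcases Int.units_eq_one_or b with rfl | rfl <;>
    decide

/-- For the wrong parity, the index sum has one to spare: shorten a cycle of `σ` by a transposition,
join to a full cycle, and restore the transposition at the cost of at most one. -/
theorem exists_index_mul_conj {S : Finset α} {σ τ : Perm α} (hS : S.Nonempty) (hσ : σ.support ⊆ S)
    (hτ : τ.support ⊆ S) (hi : S.card ≤ index σ + index τ + 1) :
    ∃ g : Perm α, g.support ⊆ S ∧ S.card ≤ index (σ * (g * τ * g⁻¹)) + 2 := by
  rcases units_eq_or_neg (Perm.sign σ * Perm.sign τ) ((-1) ^ (S.card + 1)) with h | h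
  · obtain ⟨g, hg, hf⟩ := exists_full_mul_conj hS hσ hτ hi h
    have := hf.card_le_index
    exact ⟨g, hg, by omega⟩
  by_cases h1 : σ = 1
  · subst h1
    refine ⟨1, by simp, ?_⟩
    simp at hi ⊢
    omega
  obtain ⟨f, hf⟩ : ∃ t, σ t ≠ t := by
    by_contra! h
    exact h1 (Perm.ext h)
  have hfS : f ∈ S := hσ (mem_support.2 hf)
  have hsgn : Perm.sign (swap f (σ f) * σ) * Perm.sign τ = (-1) ^ (S.card + 1) := by
    rw [sign_swap_mul hf.symm, neg_mul, h, neg_neg]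
  have h2 := index_add_mod_two hsgn
  have h3 := index_le_index_swap_mul σ f (σ f)
  have h4 : (index σ + index τ) % 2 = S.card % 2 := by
    have h5 : (-1 : ℤˣ) ^ (index σ + index τ) = (-1) ^ S.card := by
      rw [pow_add, ← sign_eq_neg_one_pow_index, ← sign_eq_neg_one_pow_index, h, pow_succ]
      simp
    rcases Nat.even_or_odd (index σ + index τ) with h1 | h1 <;>
      rcases Nat.even_or_odd S.card with h2 | h2
    · rw [Nat.even_iff.1 h1, Nat.even_iff.1 h2]
    · rw [h1.neg_one_pow, h2.neg_one_pow] at h5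
      exact absurd h5 (by decide)
    · rw [h1.neg_one_pow, h2.neg_one_pow] at h5
      exact absurd h5 (by decide)
    · rw [Nat.odd_iff.1 h1, Nat.odd_iff.1 h2]
  obtain ⟨g, hg, hfull⟩ := exists_full_mul_conj hS (support_swap_mul_subset hσ hfS
    ((apply_mem_iff_of_support_subset hσ f).2 hfS)) hτ (by omega) hsgn
  refine ⟨g, hg, ?_⟩
  have h5 := hfull.card_le_index
  have h6 := index_le_index_swap_mul (swap f (σ f) * σ * (g * τ * g⁻¹)) f (σ f)
  have h7 : swap f (σ f) * (swap f (σ f) * σ * (g * τ * g⁻¹)) = σ * (g * τ * g⁻¹) := by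
    simp [← mul_assoc]
  rw [h7] at h6
  omega

theorem exists_realizes {S : Finset α} (hS : 3 ≤ S.card) (l : List ℕ) (hl : l ≠ [])
    (h : ∀ a ∈ l, 2 ≤ a ∧ a ≤ S.card) : ∃ g : Perm α, g.support ⊆ S ∧ Realizes l g ∧
      S.card ≤ 2 * index g + 1 ∧ (2 ≤ l.length → S.card ≤ index g + 2) ∧
      Perm.sign g = (l.map fun a => (-1 : ℤˣ) ^ (S.card / a * (a - 1))).prod := by
  induction l with
  | nil => exact absurd rfl hl
  | cons a l ih =>
    have ha := h a (by simp)
    obtain ⟨σ, hσ, ho, hi, hs⟩ := exists_orderOf S ha.1 ha.2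
    by_cases hl' : l = []
    · subst hl'
      exact ⟨σ, hσ, ho ▸ realizes_singleton σ, hi, by simp, by simp [hs]⟩
    · obtain ⟨τ, hτ, hr, hi', -, hs'⟩ := ih hl' fun b hb => h b (by simp [hb])
      obtain ⟨g, hg, hle⟩ := exists_index_mul_conj (Finset.card_pos.1 (by omega)) hσ hτ (by omega)
      refine ⟨σ * (g * τ * g⁻¹), (support_mul_le _ _).trans (sup_le hσ (support_conj_subset hτ hg)),
        ho ▸ (hr.conj g).cons σ, by omega, fun _ => hle, ?_⟩
      rw [Perm.sign_mul, sign_conj_eq, hs, hs', List.map_cons, List.prod_cons]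

theorem prod_sign_eq {n : ℕ} (l : List ℕ) (h : ∀ a ∈ l, Even a → 2 ≤ a ∧ n / a = 1) :
    (l.map fun a => (-1 : ℤˣ) ^ (n / a * (a - 1))).prod = (-1) ^ l.countP (Even ·) := by
  induction l with
  | nil => simp
  | cons a l ih =>
    rw [List.map_cons, List.prod_cons, ih fun b hb => h b (by simp [hb]), List.countP_cons]
    by_cases ha : Even a
    · obtain ⟨h1, h2⟩ := h a (by simp) ha
      have h3 : Odd (a - 1) := Nat.Even.sub_odd (by omega) ha odd_one
      rw [h2, one_mul, h3.neg_one_pow]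
      simp [ha, pow_succ]
    · have h3 : Even (a - 1) := by
        rw [Nat.not_even_iff_odd] at ha
        exact Nat.Odd.sub_odd ha odd_one
      rw [(h3.mul_left _).neg_one_pow]
      simp [ha]

/-- A conjugate product of cycle type `(e, 2)` moving `e + 2` points. -/
theorem exists_mul_conj_cycleType {U : Finset α} {e : ℕ} (he : Even e) (he2 : 2 ≤ e)
    (hU : U.card = e + 2) {σ τ : Perm α} (hσ : σ.support ⊆ U) (hτ : τ.support ⊆ U) {x y w : α}
    (hw : w ∈ U) (hτw : τ w = w) (hx : σ (σ x) ≠ x) (hy : τ (τ y) ≠ y)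
    (hi : e + 2 ≤ index σ + index τ) (hs : Perm.sign σ * Perm.sign τ = 1) :
    ∃ g : Perm α, (σ * (g * τ * g⁻¹)).cycleType = e ::ₘ {2} := by
  have inj := fun a b => σ.injective.eq_iff (a := a) (b := b)
  have hUσ : ∀ z ∈ U, σ z ∈ U := fun z => (apply_mem_iff_of_support_subset hσ z).2
  have hx1 : σ x ≠ x := by grind
  have hy1 : τ y ≠ y := by grind
  have hxU : x ∈ U := hσ (mem_support.2 hx1)
  have hyU : y ∈ U := hτ (mem_support.2 hy1)
  obtain ⟨p, hp⟩ : ∃ p, p = σ x := ⟨_, rfl⟩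
  obtain ⟨q, hq⟩ : ∃ q, q = σ p := ⟨_, rfl⟩
  obtain ⟨m, hm⟩ : ∃ m, m = σ q := ⟨_, rfl⟩
  have hpU : p ∈ U := hp ▸ hUσ x hxU
  have hqU : q ∈ U := hq ▸ hUσ p hpU
  have hmU : m ∈ U := hm ▸ hUσ q hqU
  have hpq : p ≠ q := by grind
  have hqm : q ≠ m := by grind
  have hpm : p ≠ m := by grind
  have hxp : x ≠ p := by grind
  have hxq : x ≠ q := by grind
  -- Here `σ` sends x to p to q to m, possibly with m = x. Cutting out p and q leaves `ρ`, to be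
  -- joined on the other e points.
  obtain ⟨ρ, hρ⟩ : ∃ ρ, ρ = swap q m * (swap p q * σ) := ⟨_, rfl⟩
  have hρz : ∀ z, ρ z = swap q m (swap p q (σ z)) := fun z => by rw [hρ]; rfl
  have hρp : ρ p = p := by rw [hρz]; simp only [swap_apply_def]; grind
  have hρq : ρ q = q := by rw [hρz]; simp only [swap_apply_def]; grind
  have hρx : ρ x = m := by rw [hρz]; simp only [swap_apply_def]; grind
  have hσρ : σ = swap p q * (swap q m * ρ) := by simp [hρ, ← mul_assoc]
  have hρU : ρ.support ⊆ U :=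
    hρ ▸ support_swap_mul_subset (support_swap_mul_subset hσ hpU hqU) hqU hmU
  obtain ⟨h, hh, hhw, hhy⟩ : ∃ h : Perm α, h.support ⊆ U ∧ h w = p ∧ h y = q := by
    have hwy : y ≠ w := fun h => hy1 (h ▸ hτw)
    have hyp : swap w p y ≠ p := by
      rw [Ne, swap_apply_eq_iff, swap_apply_right]
      exact hwy
    have h1 := support_swap_subset hw hpU
    refine ⟨swap (swap w p y) q * swap w p, support_swap_mul_subset h1
      ((apply_mem_iff_of_support_subset h1 y).2 hyU) hqU, ?_, ?_⟩
    · rw [Perm.mul_apply, swap_apply_left, swap_apply_of_ne_of_ne hyp.symm hpq]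
    · rw [Perm.mul_apply, swap_apply_left]
  obtain ⟨κ, hκ⟩ : ∃ κ, κ = h * τ * h⁻¹ := ⟨_, rfl⟩
  have hκU : κ.support ⊆ U := hκ ▸ support_conj_subset hτ hh
  have hκh : ∀ z, κ (h z) = h (τ z) := fun z => by simp [hκ]
  have hκp : κ p = p := by rw [← hhw, hκh, hτw]
  have hκq : κ (κ q) ≠ q := by rw [← hhy, hκh, hκh]; exact fun h' => hy (h.injective h')
  have inj' := fun a b => κ.injective.eq_iff (a := a) (b := b)
  have hκq1 : κ q ≠ q := by grind
  obtain ⟨t, ht⟩ : ∃ t, t = κ q := ⟨_, rfl⟩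
  have htU : t ∈ U := ht ▸ (apply_mem_iff_of_support_subset hκU q).2 hqU
  have htp : t ≠ p := by grind
  have hκzz : ∀ z, (swap q t * κ) z = swap q t (κ z) := fun z => rfl
  have hSU : ((U.erase p).erase q).card + 2 = U.card := by
    have h1 := Finset.card_erase_add_one (Finset.mem_erase.2 ⟨hpq.symm, hqU⟩)
    have h2 := Finset.card_erase_add_one hpU
    omega
  have hsgn : Perm.sign ρ * Perm.sign (swap q t * κ) =
      (-1) ^ (((U.erase p).erase q).card + 1) := by
    rw [hρ, sign_swap_mul hqm, sign_swap_mul hpq, sign_swap_mul (by grind), hκ, sign_conj_eq,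
      neg_neg, mul_neg, hs, show ((U.erase p).erase q).card = e by omega, pow_succ,
      he.neg_one_pow, one_mul]
  obtain ⟨g, hg, hgt, hfull⟩ := joinable _ ((U.erase p).erase q) ρ (swap q t * κ) x t le_rfl
    (support_subset_erase (support_subset_erase hρU hρp) hρq)
    (support_subset_erase (support_subset_erase (support_swap_mul_subset hκU hqU htU)
      (by rw [hκzz]; simp only [swap_apply_def]; grind))
      (by rw [hκzz]; simp only [swap_apply_def]; grind))
    (by simp [hxp, hxq, hxU])
    (by rw [hκzz]; simp only [swap_apply_def]; grind)
    (by
      have h1 := index_le_index_swap_mul σ p q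
      have h2 := index_le_index_swap_mul (swap p q * σ) q m
      have h3 := index_le_index_swap_mul κ q t
      rw [← hρ] at h2
      have h4 : index κ = index τ := by rw [hκ, index_conj]
      omega) hsgn
  have hgq : g q = q := apply_eq_self_of_notMem hg (by simp)
  obtain ⟨u, hu⟩ : ∃ u, u = ρ * (g * (swap q t * κ) * g⁻¹) := ⟨_, rfl⟩
  rw [← hu] at hfull
  -- The marks pay off: as `g` takes `t` to `x` and `ρ` takes `x` to `m`, the transposition
  -- restoring `q` to `κ` becomes `swap q m` and cancels the one in `σ`. The swap of `p` and `q`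
  -- survives as the 2-cycle.
  have hprod : σ * (g * h * τ * (g * h)⁻¹) = swap p q * u := by
    have h1 : g * (swap q t * κ) * g⁻¹ = swap q x * (g * κ * g⁻¹) := by
      rw [← mul_assoc, mul_swap_eq_swap_mul, hgq, hgt]
      simp only [mul_assoc]
    have h2 : ρ * swap q x = swap q m * ρ := by rw [mul_swap_eq_swap_mul, hρq, hρx]
    rw [hu, h1, ← mul_assoc ρ, h2, hσρ, hκ]
    group
  have hup : u p = p := apply_eq_self_of_notMem hfull.2 (by simp)
  have huq : u q = q := apply_eq_self_of_notMem hfull.2 (by simp)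
  refine ⟨g * h, ?_⟩
  have hd : Perm.Disjoint (swap p q) u := by
    intro z
    by_cases h1 : z = p
    · exact Or.inr (h1 ▸ hup)
    by_cases h2 : z = q
    · exact Or.inr (h2 ▸ huq)
    exact Or.inl (swap_apply_of_ne_of_ne h1 h2)
  rw [hprod, hd.cycleType_mul, hfull.cycleType (by omega), (isCycle_swap hpq).cycleType,
    card_support_swap hpq, show ((U.erase p).erase q).card = e by omega, add_comm]
  rfl

end

/-! ### Realizing the identity, by parity -/

section

variable {α : Type*} [DecidableEq α] [Fintype α]

theorem realizes_of_full {S : Finset α} (hS : 2 ≤ S.card) {σ τ : Perm α} {l : List ℕ}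
    (hσ : σ.support ⊆ S) (hτ : τ.support ⊆ S) (hl : Realizes l τ)
    (hi : S.card ≤ index σ + index τ + 1)
    (hs : Perm.sign σ * Perm.sign τ = (-1) ^ (S.card + 1)) :
    Realizes (S.card :: orderOf σ :: l) (1 : Perm α) := by
  obtain ⟨g, hg, hf⟩ := exists_full_mul_conj (Finset.card_pos.1 (by omega)) hσ hτ hi hs
  have h1 := ((hl.conj g).cons σ).complete
  rwa [show orderOf (σ * (g * τ * g⁻¹)) = S.card from
    orderOf_eq_of_cycleType (m := 0) (hf.cycleType hS) (by simp)] at h1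

/-- An even order not exceeding `|S| - 2` is that of permutations of `S` of either parity. -/
theorem exists_orderOf_even (S : Finset α) {a k : ℕ} (ha : 2 ≤ a) (hae : Even a)
    (haS : a + 2 ≤ S.card) (hk : S.card ≤ 2 * k + 1) :
    ∃ σ : Perm α, σ.support ⊆ S ∧ orderOf σ = a ∧ S.card ≤ index σ + k + 1 ∧
      Even (index σ + k + S.card + 1) := by
  -- `j` is the number of transpositions beside an `a`-cycle: as many as fit, or one fewer if the
  -- parity is wrong, when the index bound has one to spare.
  obtain ⟨j, hj1, hj2, hj3⟩ : ∃ j, a + 2 * j ≤ S.card ∧ S.card ≤ a - 1 + j + k + 1 ∧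
      Even (a - 1 + j + k + S.card + 1) := by
    by_cases h : Even (a - 1 + (S.card - a) / 2 + k + S.card + 1)
    · exact ⟨(S.card - a) / 2, by omega, by omega, h⟩
    · rw [Nat.even_iff] at h
      exact ⟨(S.card - a) / 2 - 1, by omega, by omega, by rw [Nat.even_iff]; omega⟩
  obtain ⟨σ, hσ, hc, hi⟩ := exists_cycleType S (a ::ₘ Multiset.replicate j 2)
    (by simp; omega) (fun b hb => by
      rcases Multiset.mem_cons.1 hb with rfl | hb
      · exact ha
      · rw [Multiset.eq_of_mem_replicate hb])
  have hidx : index σ = a - 1 + j := by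
    simp at hi
    omega
  refine ⟨σ, hσ, orderOf_eq_of_cycleType hc fun b hb => ?_, by omega, by rwa [hidx]⟩
  rw [Multiset.eq_of_mem_replicate hb]
  exact hae.two_dvd

theorem realizes_of_even_le {S : Finset α} {a : ℕ} {l : List ℕ} (hl : l ≠ [])
    (h : ∀ b ∈ a :: l, 2 ≤ b ∧ b ≤ S.card) (hae : Even a) (haS : a + 2 ≤ S.card) :
    Realizes (S.card :: a :: l) (1 : Perm α) := by
  have ha := h a (by simp)
  obtain ⟨τ, hτ, hr, hi, -, -⟩ := exists_realizes (S := S) (by omega) l hl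
    fun b hb => h b (by simp [hb])
  obtain ⟨σ, hσ, ho, hi', he⟩ := exists_orderOf_even S ha.1 hae haS hi
  rw [← ho]
  refine realizes_of_full (by omega) hσ hτ hr hi' ?_
  rw [sign_eq_neg_one_pow_index, sign_eq_neg_one_pow_index, ← pow_add]
  have h1 : (-1 : ℤˣ) ^ (index σ + index τ) * (-1) ^ (S.card + 1) = 1 := by
    rw [← pow_add, ← add_assoc, he.neg_one_pow]
  rcases Int.units_eq_one_or ((-1 : ℤˣ) ^ (S.card + 1)) with h2 | h2 <;> rw [h2] at h1 ⊢
  · simpa using h1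
  · rw [mul_neg_one] at h1
    exact neg_eq_iff_eq_neg.1 h1

theorem realizes_of_parity {S : Finset α} (hS : 3 ≤ S.card) {a : ℕ} {l : List ℕ} (hl : l ≠ [])
    (h : ∀ b ∈ a :: l, 2 ≤ b ∧ b ≤ S.card) (hev : ∀ b ∈ a :: l, Even b → S.card ≤ b + 1)
    (hc : (-1 : ℤˣ) ^ (a :: l).countP (Even ·) = (-1) ^ (S.card + 1)) :
    Realizes (S.card :: a :: l) (1 : Perm α) := by
  have ha := h a (by simp)
  obtain ⟨τ, hτ, hr, hi, -, hs⟩ := exists_realizes hS l hl fun b hb => h b (by simp [hb])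
  obtain ⟨σ, hσ, ho, hi', hs'⟩ := exists_orderOf S ha.1 ha.2
  rw [← ho]
  refine realizes_of_full (by omega) hσ hτ hr (by omega) ?_
  rw [hs, hs', ← hc, ← prod_sign_eq (n := S.card) (a :: l), List.map_cons, List.prod_cons]
  intro b hb hbe
  have h1 := hev b hb hbe
  have h2 := h b hb
  refine ⟨h2.1, ?_⟩
  rw [Nat.div_eq_iff (by omega)]
  omega

theorem realizes_of_even {e : ℕ} (he : Even e) (he4 : 4 ≤ e) (hα : e + 2 ≤ Fintype.card α)
    {a : ℕ} {l : List ℕ} (hl : l ≠ []) (h : ∀ b ∈ a :: l, 2 ≤ b ∧ b ≤ e + 1)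
    (hev : ∀ b ∈ a :: l, Even b → b = e) (hc : Even ((a :: l).countP (Even ·))) :
    Realizes (e :: a :: l) (1 : Perm α) := by
  obtain ⟨U, hU⟩ := Finset.exists_subset_card_eq (s := (Finset.univ : Finset α)) (by simpa using hα)
  obtain ⟨-, hU⟩ := hU
  obtain ⟨w, hw⟩ : U.Nonempty := Finset.card_pos.1 (by omega)
  have hUw := Finset.card_erase_add_one hw
  have ha := h a (by simp)
  -- `τ` avoids `w` because the construction of type (e, 2) needs a fixed point of `τ`.
  obtain ⟨τ, hτ, hr, hi, hi2, hs⟩ := exists_realizes (S := U.erase w) (by omega) l hl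
    fun b hb => by have := h b (by simp [hb]); omega
  obtain ⟨σ, hσ, ho, hi', hs'⟩ := exists_orderOf U ha.1 (by omega)
  have hge : ∀ b ∈ a :: l, 3 ≤ b := by
    intro b hb
    by_contra hb3
    have h1 := h b hb
    have h2 : b = 2 := by omega
    have h3 := hev b hb (h2 ▸ even_two)
    omega
  have hdiv : ∀ n, n = e + 1 ∨ n = e + 2 → ∀ b ∈ a :: l, Even b → 2 ≤ b ∧ n / b = 1 := by
    intro n hn b hb hbe
    have h1 := hev b hb hbe
    refine ⟨(h b hb).1, ?_⟩
    rw [Nat.div_eq_iff (by omega)]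
    omega
  have hsgn : Perm.sign σ * Perm.sign τ = 1 := by
    have h1 := prod_sign_eq (n := U.card) [a] fun b hb =>
      hdiv _ (by omega) b (by simp at hb; simp [hb])
    have h2 := prod_sign_eq (n := (U.erase w).card) l fun b hb => hdiv _ (by omega) b (by simp [hb])
    rw [List.map_singleton, List.prod_singleton] at h1
    rw [hs, hs', h1, h2, ← pow_add, ← List.countP_append, List.singleton_append, hc.neg_one_pow]
  have hpar : Even (index σ + index τ) := by
    rw [sign_eq_neg_one_pow_index, sign_eq_neg_one_pow_index, ← pow_add] at hsgn
    by_contra hodd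
    rw [(Nat.not_even_iff_odd.1 hodd).neg_one_pow] at hsgn
    exact absurd hsgn (by decide)
  have hσ2 : ∃ x, σ (σ x) ≠ x := by
    by_contra! hinv
    have h1 : σ ^ 2 = 1 := Perm.ext fun x => by simp [pow_two, hinv]
    have h2 := Nat.le_of_dvd two_pos (orderOf_dvd_of_pow_eq_one h1)
    have h3 := hge a (by simp)
    omega
  -- An involution on e + 1 points has index at most (e + 1)/2, below the e - 1 guaranteed for two
  -- or more factors, as e ≥ 4. A single factor has order at least 3.
  have hτ2 : ∃ y, τ (τ y) ≠ y := by
    by_contra! hinv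
    rcases Nat.lt_or_ge 1 l.length with hlen | hlen
    · have h1 := two_mul_index_le_of_mul_self hinv
      have h2 := Finset.card_le_card hτ
      have h3 := hi2 hlen
      omega
    · obtain ⟨b, rfl⟩ : ∃ b, l = [b] :=
        List.length_eq_one_iff.1 (le_antisymm hlen (List.length_pos_iff.2 hl))
      have h1 : τ ^ 2 = 1 := Perm.ext fun x => by simp [pow_two, hinv]
      have h2 := Nat.le_of_dvd two_pos (orderOf_dvd_of_pow_eq_one h1)
      have h3 := hge b (by simp)
      rw [hr.orderOf_eq] at h2
      omega
  obtain ⟨x, hx⟩ := hσ2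
  obtain ⟨y, hy⟩ := hτ2
  -- The two index bounds add up to e + 1; evenness of the sum gives the required e + 2.
  obtain ⟨g, hg⟩ := exists_mul_conj_cycleType he (by omega) hU hσ
    (hτ.trans (Finset.erase_subset _ _)) hw (apply_eq_self_of_notMem hτ (by simp)) hx hy
    (by rw [Nat.even_iff] at he hpar; omega) hsgn
  have h1 := ((hr.conj g).cons σ).complete
  rwa [ho, orderOf_eq_of_cycleType hg (by simpa using he.two_dvd)] at h1

theorem realizes_replicate_two (k : ℕ) (hk : k ≠ 1) :
    Realizes (List.replicate k 2) (1 : Perm (Fin 4)) := by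
  induction k using Nat.strong_induction_on with
  | _ k ih =>
    match k, hk with
    | 0, _ => exact realizes_nil
    | 3, _ =>
      refine ⟨[swap 0 1 * swap 2 3, swap 0 2 * swap 1 3, swap 0 3 * swap 1 2], ?_, by decide⟩
      simp only [List.map_cons, List.map_nil, List.replicate]
      rw [orderOf_eq_prime (p := 2) (by decide) (by decide),
        orderOf_eq_prime (p := 2) (by decide) (by decide),
        orderOf_eq_prime (p := 2) (by decide) (by decide)]
    | 2, _ =>
      exact realizes_nil.cons_cons_two (x := swap 0 1)
        (orderOf_eq_prime (by decide) (by decide))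
    | k + 4, _ =>
      exact (ih (k + 2) (by omega) (by omega)).cons_cons_two (x := swap 0 1)
        (orderOf_eq_prime (by decide) (by decide))

/-- The seeds (3, 3, 2) and (2, 2, 2, 3) are padded by pairs of equal involutions and by duplicating
a 3; the hypothesis excludes the impossible (2, 3). -/
theorem realizes_two_three (j k : ℕ) (hjk : j + k ≠ 0) :
    Realizes (List.replicate (2 * j + 1) 2 ++ List.replicate (k + 1) 3) (1 : Perm (Fin 5)) := by
  have two : ∀ j : ℕ, ∀ l : List ℕ, Realizes l (1 : Perm (Fin 5)) →
      Realizes (List.replicate (2 * j) 2 ++ l) (1 : Perm (Fin 5)) := by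
    intro j l hl
    induction j with
    | zero => simpa using hl
    | succ j ih =>
      exact ih.cons_cons_two (x := swap 0 1) (orderOf_eq_prime (by decide) (by decide))
  have three : ∀ k : ℕ, ∀ l : List ℕ, Realizes (3 :: l) (1 : Perm (Fin 5)) →
      Realizes (List.replicate (k + 1) 3 ++ l) (1 : Perm (Fin 5)) := by
    intro k l hl
    induction k with
    | zero => simpa using hl
    | succ k ih => exact ih.duplicate (by decide)
  have h233 : Realizes [3, 3, 2] (1 : Perm (Fin 5)) := by
    refine ⟨[swap 0 1 * swap 1 2, swap 1 2 * swap 2 3, swap 2 3 * swap 0 1], ?_, by decide⟩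
    simp only [List.map_cons, List.map_nil]
    rw [orderOf_eq_prime (p := 3) (by decide) (by decide),
      orderOf_eq_prime (p := 3) (by decide) (by decide),
      orderOf_eq_prime (p := 2) (by decide) (by decide)]
  have h2223 : Realizes [2, 2, 2, 3] (1 : Perm (Fin 5)) := by
    refine ⟨[swap 0 1, swap 1 2 * swap 3 4, swap 3 4, swap 1 2 * swap 0 1], ?_, by decide⟩
    simp only [List.map_cons, List.map_nil]
    rw [orderOf_eq_prime (p := 2) (by decide) (by decide),
      orderOf_eq_prime (p := 2) (by decide) (by decide),
      orderOf_eq_prime (p := 2) (by decide) (by decide),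
      orderOf_eq_prime (p := 3) (by decide) (by decide)]
  match k with
  | 0 =>
    obtain ⟨j, rfl⟩ := Nat.exists_eq_add_of_le' (show 1 ≤ j by omega)
    refine (two j _ h2223).perm ?_
    rw [show 2 * (j + 1) + 1 = 2 * j + 3 by ring, List.replicate_add, List.append_assoc]
    rfl
  | k + 1 =>
    refine (two j _ (three k [3, 2] h233)).perm (List.perm_iff_count.2 fun b => ?_)
    simp only [List.count_append, List.count_replicate, List.count_cons, List.count_nil]
    grind

theorem countP_even_replicate (j k : ℕ) :
    (List.replicate j 2 ++ List.replicate k 3).countP (Even ·) = j := by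
  have h : ¬ Even 3 := by decide
  simp [List.countP_replicate, h]

theorem perm_replicate_two_three (l : List ℕ) (h : ∀ a ∈ l, a = 2 ∨ a = 3) :
    l.Perm (List.replicate (l.count 2) 2 ++ List.replicate (l.count 3) 3) := by
  rw [List.perm_iff_count]
  intro b
  simp only [List.count_append, List.count_replicate]
  by_cases h2 : b = 2
  · simp [h2]
  by_cases h3 : b = 3
  · simp [h3]
  rw [List.count_eq_zero.2 fun hb => (h b hb).elim h2 h3]
  simp [Ne.symm h2, Ne.symm h3]

theorem realizes_one {c : ℕ} (L : List ℕ) (hlen : 3 ≤ L.length) (hcL : c ∈ L)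
    (hL : ∀ a ∈ L, 2 ≤ a ∧ a ≤ c) : Realizes L (1 : Perm (Fin (c + 2))) := by
  have hc2 := (hL c hcL).1
  obtain rfl | hc3 := hc2.eq_or_lt
  · rw [List.eq_replicate_iff.2 ⟨rfl, fun a ha => le_antisymm (hL a ha).2 (hL a ha).1⟩]
    exact realizes_replicate_two _ (by omega)
  obtain ⟨S, -, hS⟩ := Finset.exists_subset_card_eq
    (s := (Finset.univ : Finset (Fin (c + 2)))) (n := c) (by simp)
  have hperm := List.perm_cons_erase hcL
  obtain ⟨l, hl⟩ : ∃ l, l = L.erase c := ⟨_, rfl⟩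
  rw [← hl] at hperm
  have hllen : l.length + 1 = L.length := by simpa using hperm.length_eq.symm
  have hlL : ∀ a ∈ l, 2 ≤ a ∧ a ≤ c := fun a ha =>
    hL a (hperm.mem_iff.2 (List.mem_cons_of_mem c ha))
  refine Realizes.perm hperm.symm ?_
  by_cases hI : ∃ a ∈ l, Even a ∧ a + 2 ≤ c
  · obtain ⟨a, hal, hae, hac⟩ := hI
    have hp := List.perm_cons_erase hal
    have hlen' : (l.erase a).length + 1 = l.length := by simpa using hp.length_eq.symm
    refine Realizes.perm (hp.symm.cons c) ?_
    have := realizes_of_even_le (S := S) (a := a) (l := l.erase a)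
      (List.ne_nil_of_length_pos (by omega)) (fun b hb => hS.symm ▸ hlL b (hp.mem_iff.2 hb)) hae
      (by omega)
    rwa [hS] at this
  push Not at hI
  have hev : ∀ a ∈ l, Even a → c ≤ a + 1 := fun a ha hae => by have := hI a ha hae; omega
  obtain ⟨a, l₀, rfl⟩ := List.exists_cons_of_length_pos (l := l) (by omega)
  have hl₀ : l₀ ≠ [] := List.ne_nil_of_length_pos (by simp at hllen; omega)
  by_cases hpar : Even ((a :: l₀).countP (Even ·) + c + 1)
  · have := realizes_of_parity (S := S) (by omega) (a := a) hl₀ (by rwa [hS]) (by rwa [hS]) (by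
      rw [hS]
      rw [add_assoc] at hpar
      rcases Nat.even_or_odd (c + 1) with h | h
      · rw [h.neg_one_pow, ((Nat.even_add.1 hpar).2 h).neg_one_pow]
      · rw [h.neg_one_pow, (Nat.not_even_iff_odd.1 fun h' =>
          Nat.not_even_iff_odd.2 h ((Nat.even_add.1 hpar).1 h')).neg_one_pow])
    rwa [hS] at this
  -- Parity is wrong. For even c, the entry set aside takes type (c, 2). For odd c, an odd number of
  -- entries equal c - 1; one of them is set aside instead and c returns to the rest.
  rcases Nat.even_or_odd c with hce | hco
  · refine realizes_of_even hce (by rw [Nat.even_iff] at hce; omega) (by simp) hl₀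
      (fun b hb => ⟨(hlL b hb).1, by have := hlL b hb; omega⟩) (fun b hb hbe => ?_) ?_
    · have h1 := hev b hb hbe
      have h2 := hlL b hb
      rw [Nat.even_iff] at hce hbe
      omega
    · rw [Nat.even_iff] at hce hpar ⊢
      omega
  · have hodd : Odd ((a :: l₀).countP (Even ·)) := by
      rw [Nat.even_iff] at hpar
      rw [Nat.odd_iff] at hco ⊢
      omega
    obtain ⟨e, hel, hee⟩ := List.countP_pos_iff.1 hodd.pos
    have hee : Even e := by simpa using hee
    have hec : c = e + 1 := by
      have h1 := hev e hel hee
      have h2 := hlL e hel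
      rw [Nat.even_iff] at hee
      rw [Nat.odd_iff] at hco
      omega
    by_cases he4 : 4 ≤ e
    · have hp := List.perm_cons_erase hel
      obtain ⟨l₁, hl₁⟩ : ∃ l₁, l₁ = (a :: l₀).erase e := ⟨_, rfl⟩
      rw [← hl₁] at hp
      have hlen' : l₁.length + 1 = (a :: l₀).length := by simpa using hp.length_eq.symm
      have hmem : ∀ b ∈ l₁, b ∈ a :: l₀ := fun b hb => hp.mem_iff.2 (List.mem_cons_of_mem e hb)
      refine Realizes.perm ((List.Perm.swap c e l₁).trans (hp.symm.cons c)) ?_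
      refine realizes_of_even hee he4 (by simp; omega) (List.ne_nil_of_length_pos (by omega)) ?_ ?_ ?_
      · intro b hb
        rcases List.mem_cons.1 hb with rfl | hb
        · omega
        · have := hlL b (hmem b hb)
          omega
      · intro b hb hbe
        rcases List.mem_cons.1 hb with rfl | hb
        · exact absurd hbe (Nat.not_even_iff_odd.2 hco)
        · have h1 := hev b (hmem b hb) hbe
          have h2 := hlL b (hmem b hb)
          rw [Nat.even_iff] at hbe
          rw [Nat.odd_iff] at hco
          omega
      · rw [hp.countP_eq, List.countP_cons_of_pos (by simpa using hee)] at hodd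
        rw [List.countP_cons_of_neg (by simpa using hco)]
        rw [Nat.odd_iff] at hodd
        rw [Nat.even_iff]
        omega
    · obtain rfl : c = 3 := by
        rw [Nat.even_iff] at hee
        omega
      have h23 : ∀ b ∈ a :: l₀, b = 2 ∨ b = 3 := fun b hb => by have := hlL b hb; omega
      have hp := perm_replicate_two_three _ h23
      rw [hp.countP_eq, countP_even_replicate] at hodd
      obtain ⟨j, hj⟩ := hodd
      have hlen' := hp.length_eq
      rw [List.length_append, List.length_replicate, List.length_replicate] at hlen'
      rw [hj] at hp hlen'
      refine Realizes.perm (List.Perm.trans ?_ (hp.symm.cons 3))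
        (realizes_two_three j ((a :: l₀).count 3) (by omega))
      rw [List.replicate_succ]
      exact List.perm_middle

end

end PermOrders

theorem mainTheorem2 (r : ℕ) (hr : 3 ≤ r) (a : Fin r → ℕ) (ha : ∀ i, 1 < a i) :
    ∃ x : Fin r → Equiv.Perm (Fin (Finset.univ.sup a + 2)),
      (∀ i, orderOf (x i) = a i) ∧ (List.ofFn x).prod = 1 := by
  have hne : (Finset.univ : Finset (Fin r)).Nonempty := ⟨⟨0, by omega⟩, Finset.mem_univ _⟩
  obtain ⟨i, -, hi⟩ := Finset.exists_mem_eq_sup Finset.univ hne a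
  obtain ⟨xs, h1, h2⟩ := PermOrders.realizes_one (c := Finset.univ.sup a) (List.ofFn a)
    (by simpa using hr) (List.mem_ofFn.2 ⟨i, hi.symm⟩) fun b hb => by
      obtain ⟨j, rfl⟩ := List.mem_ofFn.1 hb
      exact ⟨ha j, Finset.le_sup (Finset.mem_univ j)⟩
  have hlen : xs.length = r := by simpa using congrArg List.length h1
  obtain ⟨x, rfl⟩ : ∃ x : Fin r → Equiv.Perm (Fin (Finset.univ.sup a + 2)), xs = List.ofFn x :=
    ⟨fun i => xs.get (i.cast hlen.symm), List.ext_getElem (by simp [hlen]) (by simp)⟩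
  rw [List.map_ofFn] at h1
  exact ⟨x, congrFun (List.ofFn_injective h1), h2⟩
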